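/- **Setting.** Let $(K,v)$ be a henselian valued field, i.e. $v$ has, up to equivalence, a unique extension to an algebraic closure $\overline K$. Let $\Lambda$ be a divisible (torsion-free) ordered abelian group containing the value group $v(K^*)$, hence its divisible hull; $v$ also denotes the extension $\overline K\to\Lambda\cup\{\infty\}$. Let $\mu\colon K[x]\to\Lambda\cup\{\infty\}$ be any valuation extending $v$; its support need not be zero. (The nodes of the tree $\mathcal T_{\mathrm{sme}}$ of the small-extensions closure are such valuations, for a particular ordered real vector space $\Lambda$.) For $F\in K[x]$ monic irreducible with root $\theta\in\overline K$, put $v_F(f)=v(f(\theta))$ for $f\in K[x]$; by henselianity this does not depend on $\theta$. Let $\mathcal G_\mu=\bigoplus_{\alpha}\{g:\mu(g)\ge\alpha\}/\{g:\mu(g)>\alpha\}$ be the graded algebra of $\mu$, and $\operatorname{in}_\mu\colon K[x]\to\mathcal G_\mu$ the initial term map: $\operatorname{in}_\mu g=0$ if $\mu(g)=\infty$, and otherwise $\operatorname{in}_\mu g$ is the class of $g$ in degree $\mu(g)$. Write $g\sim_\mu h$ if $\operatorname{in}_\mu g=\operatorname{in}_\mu h$, and $h\mid_\mu g$ if $\operatorname{in}_\mu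 h\mid\operatorname{in}_\mu g$ in $\mathcal G_\mu$. A key polynomial for $\mu$ is a monic $\phi\in K[x]$ such that $(\operatorname{in}_\mu\phi)\,\mathcal G_\mu$ is a nonzero prime ideal and $\phi\nmid_\mu f$ for all nonzero $f\in K[x]$ with $\deg f<\deg\phi$. For a key polynomial $\phi$ and $f=\sum_{s\ge0}a_s\phi^s$ with $\deg a_s<\deg\phi$, the Newton polygon $N_{\mu,\phi}(f)$ is the lower boundary of the convex hull in $\mathbb Q\times\Lambda$ of the points $(s,\mu(a_s))$ with $\mu(a_s)<\infty$. It is one-sided of slope $\sigma\in\Lambda$ if it is a single segment of slope $\sigma$ from a point of abscissa $0$ to a point of positive integer abscissa. **Theorem.** Let $F\in K[x]$ be monic irreducible and let $\phi$ be a key polynomial for $\mu$. Then $$\phi\mid_\mu F\iff \mu(\phi)<v_F(\phi).$$ Moreover, if this condition holds, then: 1. either $F=\phi$, or $v_F(\phi)<\infty$ and the Newton polygon $N_{\mu,\phi}(F)$ is one-sided of slope $-v_F(\phi)$; 2. $\deg\phi$ divides $\deg F$, and $F\sim_\mu\phi^{\ell}$ with $\ell=\deg F/\deg\phi$. -/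

import Mathlib

open Polynomial DirectSum

noncomputable section

namespace ValTree

universe u w

variable {K : Type u} [Field K]
variable {Λ : Type w} [AddCommGroup Λ] [LinearOrder Λ] [IsOrderedAddMonoid Λ]

/-- A valued field `(K, v)` is henselian if `v` has, up to equivalence, a unique extension to an
algebraic closure of `K`. Equivalence classes of valuations are identified with valuation rings:
there is exactly one valuation ring of the algebraic closure lying over the valuation ring
`{a | 0 ≤ v a}` of `v`. -/
def IsHenselian (v : AddValuation K (WithTop Λ)) : Prop :=
  ∃! O : ValuationSubring (AlgebraicClosure K),
    ∀ a : K, algebraMap K (AlgebraicClosure K) a ∈ O ↔ 0 ≤ v a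

/-- `μ` is a node of the valuative tree `𝒯(Λ)` of `v`: a valuation on `K[x]` with values in
`Λ ∪ {∞}` whose restriction to `K` is `v`. -/
def IsNode (v : AddValuation K (WithTop Λ)) (μ : AddValuation K[X] (WithTop Λ)) : Prop :=
  ∀ a : K, μ (C a) = v a

/-- The valuation `f ↦ w (f(θ))` on `K[x]`, for a valuation `w` of the algebraic closure and a
point `θ` of it. If `(K, v)` is henselian, `w` extends `v` and `θ` is a root of `F ∈ Irr(K)`,
this is `v_F`. -/
def evalValuation (w : AddValuation (AlgebraicClosure K) (WithTop Λ)) (θ : AlgebraicClosure K) :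
    AddValuation K[X] (WithTop Λ) :=
  w.comap (aeval (R := K) θ).toRingHom

section Graded

variable (μ : AddValuation K[X] (WithTop Λ))

/-- `𝒫_α = {g | μ(g) ≥ α}`. -/
def geSubgroup (α : Λ) : AddSubgroup K[X] where
  carrier := {g | (α : WithTop Λ) ≤ μ g}
  zero_mem' := by simp
  add_mem' := fun {a b} ha hb => μ.map_le_add ha hb
  neg_mem' := fun {a} ha => by simpa using ha

/-- `𝒫_α⁺ = {g | μ(g) > α}`. -/
def gtSubgroup (α : Λ) : AddSubgroup K[X] where
  carrier := {g | (α : WithTop Λ) < μ g}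
  zero_mem' := by simp
  add_mem' := fun {a b} ha hb => μ.map_lt_add ha hb
  neg_mem' := fun {a} ha => by simpa using ha

theorem mem_geSubgroup {α : Λ} {g : K[X]} : g ∈ geSubgroup μ α ↔ (α : WithTop Λ) ≤ μ g := Iff.rfl

theorem mem_gtSubgroup {α : Λ} {g : K[X]} : g ∈ gtSubgroup μ α ↔ (α : WithTop Λ) < μ g := Iff.rfl

/-- The homogeneous component `𝒫_α / 𝒫_α⁺` of degree `α`. It is zero unless `α` is the `μ`-value
of some polynomial. -/
abbrev Piece (α : Λ) : Type u :=
  geSubgroup μ α ⧸ (gtSubgroup μ α).addSubgroupOf (geSubgroup μ α)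

/-- The class of `g ∈ 𝒫_α` in `𝒫_α / 𝒫_α⁺`. -/
def Piece.mk (α : Λ) (g : K[X]) (hg : (α : WithTop Λ) ≤ μ g) : Piece μ α :=
  QuotientAddGroup.mk (⟨g, hg⟩ : geSubgroup μ α)

theorem Piece.mk_eq_iff {α : Λ} {g h : K[X]} (hg : (α : WithTop Λ) ≤ μ g)
    (hh : (α : WithTop Λ) ≤ μ h) :
    Piece.mk μ α g hg = Piece.mk μ α h hh ↔ (α : WithTop Λ) < μ (h - g) := by
  unfold Piece.mk
  rw [QuotientAddGroup.eq, AddSubgroup.mem_addSubgroupOf, mem_gtSubgroup]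
  simp [sub_eq_neg_add]

theorem Piece.exists_mk {α : Λ} (a : Piece μ α) : ∃ g hg, a = Piece.mk μ α g hg := by
  induction a using QuotientAddGroup.induction_on with
  | H z => exact ⟨z.1, z.2, rfl⟩

theorem le_map_mul {α β : Λ} {g h : K[X]} (hg : (α : WithTop Λ) ≤ μ g)
    (hh : (β : WithTop Λ) ≤ μ h) : ((α + β : Λ) : WithTop Λ) ≤ μ (g * h) := by
  rw [μ.map_mul, WithTop.coe_add]
  exact add_le_add hg hh

theorem lt_map_mul {α β : Λ} {g h : K[X]} (hg : (α : WithTop Λ) < μ g)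
    (hh : (β : WithTop Λ) ≤ μ h) : ((α + β : Λ) : WithTop Λ) < μ (g * h) := by
  rw [μ.map_mul, WithTop.coe_add]
  exact WithTop.add_lt_add_of_lt_of_le (WithTop.coe_ne_top) hg hh

/-- Multiplication `𝒫_α/𝒫_α⁺ × 𝒫_β/𝒫_β⁺ → 𝒫_{α+β}/𝒫_{α+β}⁺` induced by that of `K[x]`. -/
def Piece.mul {α β : Λ} (a : Piece μ α) (b : Piece μ β) : Piece μ (α + β) :=
  Quotient.liftOn₂' a b (fun g h => Piece.mk μ (α + β) (g.1 * h.1) (le_map_mul μ g.2 h.2)) (by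
    rintro ⟨g, hg⟩ ⟨h, hh⟩ ⟨g', hg'⟩ ⟨h', hh'⟩ h1 h2
    rw [QuotientAddGroup.leftRel_apply, AddSubgroup.mem_addSubgroupOf, mem_gtSubgroup] at h1 h2
    rw [Piece.mk_eq_iff]
    have e : g' * h' - g * h = (-g + g') * h' + (-h + h') * g := by ring
    simp only [e]
    refine μ.map_lt_add (lt_map_mul μ h1 hh') ?_
    rw [add_comm α β]
    exact lt_map_mul μ h2 hg)

theorem Piece.mk_add_mk {α : Λ} {g h : K[X]} (hg : (α : WithTop Λ) ≤ μ g)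
    (hh : (α : WithTop Λ) ≤ μ h) :
    Piece.mk μ α g hg + Piece.mk μ α h hh = Piece.mk μ α (g + h) (μ.map_le_add hg hh) := rfl

theorem Piece.zero_eq_mk (α : Λ) : (0 : Piece μ α) = Piece.mk μ α 0 (by simp) := rfl

theorem Piece.sigma_mk_eq {α β : Λ} (e : α = β) {g h : K[X]} (f : g = h)
    (hg : (α : WithTop Λ) ≤ μ g) (hh : (β : WithTop Λ) ≤ μ h) :
    (GradedMonoid.mk α (Piece.mk μ α g hg) : GradedMonoid (Piece μ)) =
      GradedMonoid.mk β (Piece.mk μ β h hh) := by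
  subst e f; rfl

theorem zero_le_map_one : ((0 : Λ) : WithTop Λ) ≤ μ 1 := by simp

instance gMul : GradedMonoid.GMul (Piece μ) where
  mul := Piece.mul μ

theorem Piece.mk_mul_mk {α β : Λ} {g h : K[X]} (hg : (α : WithTop Λ) ≤ μ g)
    (hh : (β : WithTop Λ) ≤ μ h) :
    GradedMonoid.GMul.mul (Piece.mk μ α g hg) (Piece.mk μ β h hh) =
      Piece.mk μ (α + β) (g * h) (le_map_mul μ hg hh) := rfl

instance gOne : GradedMonoid.GOne (Piece μ) where
  one := Piece.mk μ 0 1 (zero_le_map_one μ)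

instance gCommRing : DirectSum.GCommRing (Piece μ) where
  toGMul := gMul μ
  toGOne := gOne μ
  mul_zero := by
    intro α β a
    obtain ⟨g, hg, rfl⟩ := Piece.exists_mk μ a
    rw [Piece.zero_eq_mk, Piece.zero_eq_mk, Piece.mk_mul_mk]
    simp
  zero_mul := by
    intro α β a
    obtain ⟨g, hg, rfl⟩ := Piece.exists_mk μ a
    rw [Piece.zero_eq_mk, Piece.zero_eq_mk, Piece.mk_mul_mk]
    simp
  mul_add := by
    intro α β a b c
    obtain ⟨g, hg, rfl⟩ := Piece.exists_mk μ a
    obtain ⟨h, hh, rfl⟩ := Piece.exists_mk μ b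
    obtain ⟨k, hk, rfl⟩ := Piece.exists_mk μ c
    simp only [Piece.mk_add_mk, Piece.mk_mul_mk, mul_add]
  add_mul := by
    intro α β a b c
    obtain ⟨g, hg, rfl⟩ := Piece.exists_mk μ a
    obtain ⟨h, hh, rfl⟩ := Piece.exists_mk μ b
    obtain ⟨k, hk, rfl⟩ := Piece.exists_mk μ c
    simp only [Piece.mk_add_mk, Piece.mk_mul_mk, add_mul]
  one_mul := by
    rintro ⟨α, a⟩
    obtain ⟨g, hg, rfl⟩ := Piece.exists_mk μ a
    exact Piece.sigma_mk_eq μ (zero_add α) (one_mul g) _ _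
  mul_one := by
    rintro ⟨α, a⟩
    obtain ⟨g, hg, rfl⟩ := Piece.exists_mk μ a
    exact Piece.sigma_mk_eq μ (add_zero α) (mul_one g) _ _
  mul_assoc := by
    rintro ⟨α, a⟩ ⟨β, b⟩ ⟨γ, c⟩
    obtain ⟨g, hg, rfl⟩ := Piece.exists_mk μ a
    obtain ⟨h, hh, rfl⟩ := Piece.exists_mk μ b
    obtain ⟨k, hk, rfl⟩ := Piece.exists_mk μ c
    exact Piece.sigma_mk_eq μ (add_assoc α β γ) (mul_assoc g h k) _ _
  mul_comm := by
    rintro ⟨α, a⟩ ⟨β, b⟩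
    obtain ⟨g, hg, rfl⟩ := Piece.exists_mk μ a
    obtain ⟨h, hh, rfl⟩ := Piece.exists_mk μ b
    exact Piece.sigma_mk_eq μ (add_comm α β) (mul_comm g h) _ _
  natCast := fun n => n • Piece.mk μ 0 1 (zero_le_map_one μ)
  natCast_zero := zero_nsmul _
  natCast_succ := fun n => succ_nsmul _ n
  intCast := fun n => n • Piece.mk μ 0 1 (zero_le_map_one μ)
  intCast_ofNat := fun n => natCast_zsmul _ n
  intCast_negSucc_ofNat := fun n => negSucc_zsmul _ n

/-- The graded algebra `𝒢_μ = ⨁_α 𝒫_α / 𝒫_α⁺`. Letting `α` run over `Λ` instead of the value group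
of `μ` only adds zero components. -/
abbrev GradedAlg : Type (max u w) := ⨁ α : Λ, Piece μ α

open Classical in
/-- The initial term map `in_μ : K[x] → 𝒢_μ`. It sends the support of `μ` to `0`, and any other `g`
to its class in the component of degree `μ(g)`. -/
def initialTerm (g : K[X]) : GradedAlg μ :=
  if hg : μ g = ⊤ then 0
  else DirectSum.of (Piece μ) ((μ g).untop hg)
    (Piece.mk μ ((μ g).untop hg) g (by rw [WithTop.coe_untop]))

/-- `g ∼_μ h`. -/
def MuEquiv (g h : K[X]) : Prop := initialTerm μ g = initialTerm μ h

/-- `h ∣_μ g`. -/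
def MuDvd (h g : K[X]) : Prop := initialTerm μ h ∣ initialTerm μ g

/-- `g` is `μ`-irreducible: `in_μ g` generates a nonzero prime ideal of `𝒢_μ`. -/
def MuIrreducible (g : K[X]) : Prop :=
  Ideal.span {initialTerm μ g} ≠ ⊥ ∧ (Ideal.span {initialTerm μ g}).IsPrime

/-- `g` is `μ`-minimal. -/
def MuMinimal (g : K[X]) : Prop := ∀ f : K[X], f ≠ 0 → f.degree < g.degree → ¬ MuDvd μ g f

/-- MacLane–Vaquié key polynomials for `μ`. -/
structure IsKeyPolynomial (φ : K[X]) : Prop where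
  monic : φ.Monic
  minimal : MuMinimal μ φ
  irreducible : MuIrreducible μ φ

end Graded

/-- The `s`-th coefficient `a_s` of the `φ`-expansion `f = ∑ a_s φ^s`, `deg a_s < deg φ`, of `f` with
respect to a monic polynomial `φ` of positive degree: the remainder modulo `φ` of the quotient of
`f` by `φ^s`. -/
def expansionCoeff (φ f : K[X]) (s : ℕ) : K[X] := (f /ₘ φ ^ s) %ₘ φ

section Newton

variable [Module ℚ Λ]

/-- The cloud of points `(s, μ(a_s))`, `a_s ≠ 0`, where `f = ∑ a_s φ^s` is the `φ`-expansion. -/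
def newtonCloud (μ : AddValuation K[X] (WithTop Λ)) (φ f : K[X]) : Set (ℚ × Λ) :=
  {p | ∃ s : ℕ, p.1 = s ∧ (p.2 : WithTop Λ) = μ (expansionCoeff φ f s)}

/-- The Newton polygon `N_{μ,φ}(f)`: the lower boundary of the convex hull of the cloud of points
`(s, μ(a_s))` in `ℚ × Λ`. -/
def newtonPolygon (μ : AddValuation K[X] (WithTop Λ)) (φ f : K[X]) : Set (ℚ × Λ) :=
  {p | p ∈ convexHull ℚ (newtonCloud μ φ f) ∧
    ∀ y : Λ, (p.1, y) ∈ convexHull ℚ (newtonCloud μ φ f) → p.2 ≤ y}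

/-- `N` is one-sided of slope `σ`: it is a single segment of slope `σ` and positive length,
starting on the vertical axis. -/
def IsOneSided (N : Set (ℚ × Λ)) (σ : Λ) : Prop :=
  ∃ (y : Λ) (l : ℕ), 0 < l ∧ N = segment ℚ (0, y) ((l : ℚ), y + l • σ)

end Newton

end ValTree

end

/-! Write `w` for the valuation of the algebraic closure. A key polynomial forces `μ` to have zero
support, so `μ` extends to `K(x)` and to an algebraic closure of it. By henselianity the result
induces `w` on the algebraic closure of `K`, and pulling back gives a valuation `ν` on polynomials
over that closure, extending both `μ` and `w`. Let `α` be a root of `φ` with `δ = ν(x - α)` maximal.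
The crux, `map_X_sub_C_le`, is that `δ` bounds `ν(x - β)` for every algebraic `β`, not only for
roots of `φ`. Hence `ν(x - β) = min(δ, w(α - β))`, and `μ(f)` is read off the roots of `f`: always
`μ(f) ≤ w(f(α))`, strictly iff `f` has a root in the open ball `w(α - β) > δ`, and with equality if
`deg f < deg φ`. As `φ ∣_μ f` means `μ(f) < μ(f mod φ)`, divisibility becomes the existence of a
root in that ball; comparing factors over the roots of `φ` gives the criterion. Now let `F ≠ φ`, `γ
= v_F(φ)`, let `η` be the root of `F` closest to `α`, and let `t` be a generic point at distance
`w(α - η)` from `α`. Evaluation at `t` gives `φ` the value `γ`, `F` the value `w(F(α))`, and each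
`a` with `deg a < deg φ` the value `μ(a)`. Hence `w(F(α)) ≤ μ(a_s) + s γ`: the cloud lies above a
line of slope `-γ`. The resultant identity `deg φ · w(F(α)) = deg F · γ`, with the bound `deg φ ·
μ(a) ≤ deg a · μ(φ)` for monic `a`, forces the top coefficient to be `1`. So the line ends at `(ℓ,
0)`, and since `γ > μ(φ)` the terms with `s < ℓ` have value above `μ(φ^ℓ)`. -/

noncomputable section

namespace ValTree

universe u w

/-! ### Extending valuations to algebraic closures -/

section Extension

variable {Λ : Type w} [AddCommGroup Λ] [LinearOrder Λ] [IsOrderedAddMonoid Λ]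

/-- The valuation ring `{x | 0 ≤ w x}` of an additive valuation on a field. -/
def ringOfNonneg {L : Type*} [Field L] (w : AddValuation L (WithTop Λ)) : ValuationSubring L where
  carrier := {x | 0 ≤ w x}
  zero_mem' := by simp
  one_mem' := by simp
  add_mem' := fun ha hb => w.map_le_add ha hb
  mul_mem' := fun {a b} ha hb => by
    rw [Set.mem_ofPred_eq, w.map_mul]
    exact add_nonneg ha hb
  neg_mem' := fun {a} ha => by simpa using ha
  mem_or_inv_mem' := fun x => by
    by_contra! h
    simp only [Set.mem_ofPred_eq, not_le] at h
    rcases eq_or_ne x 0 with rfl | hx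
    · simp at h
    · have h1 : w x + w x⁻¹ = 0 := by rw [← w.map_mul, mul_inv_cancel₀ hx, w.map_one]
      have h2 : w x + w x⁻¹ < 0 := by
        calc w x + w x⁻¹ ≤ w x + 0 := by gcongr; exact h.2.le
          _ < 0 := by simpa using h.1
      exact h2.ne h1

theorem mem_ringOfNonneg {L : Type*} [Field L] {w : AddValuation L (WithTop Λ)} {x : L} :
    x ∈ ringOfNonneg w ↔ 0 ≤ w x := Iff.rfl

theorem map_div_nonneg_iff {L : Type*} [Field L] (w : AddValuation L (WithTop Λ)) {x y : L}
    (hy : y ≠ 0) : 0 ≤ w (x / y) ↔ w y ≤ w x := by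
  have hy' : w y ≠ ⊤ := w.ne_top_iff.2 hy
  have h1 : w (x / y) + w y = w x := by rw [← w.map_mul, div_mul_cancel₀ _ hy]
  rw [← h1]
  lift w y to Λ using hy' with b
  cases w (x / y) with
  | top => simp
  | coe a => norm_cast; simp

/-- Over a subfield `M`, some power of an algebraic element has the value of an element of `M`. -/
theorem exists_pow_valuation_eq {M L Γ : Type*} [Field M] [Field L] [Algebra M L]
    [LinearOrderedCommGroupWithZero Γ] (ν : Valuation L Γ) {x : L} (hx0 : x ≠ 0)
    (hx : IsAlgebraic M x) :
    ∃ n : ℕ, 0 < n ∧ ∃ a : M, a ≠ 0 ∧ ν (x ^ n) = ν (algebraMap M L a) := by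
  obtain ⟨p, hp0, hp⟩ := hx
  let T : ℕ → L := fun i => algebraMap M L (p.coeff i) * x ^ i
  have hsum : ∑ i ∈ p.support, T i = 0 := by
    rw [← hp, aeval_def, eval₂_eq_sum, Polynomial.sum_def]
  have hT : ∀ i ∈ p.support, T i ≠ 0 := fun i hi =>
    mul_ne_zero (by simpa using hi) (pow_ne_zero _ hx0)
  obtain ⟨i, hi, hmax⟩ := p.support.exists_max_image (fun i => ν (T i)) (by simpa using hp0)
  -- A sum that vanishes cannot have a unique dominant term.
  have hj : ∃ j ∈ p.support, j ≠ i ∧ ν (T j) = ν (T i) := by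
    by_contra! h
    have := ν.map_sum_eq_of_lt hi (f := T) (by
      intro j hj
      simp only [Finset.mem_sdiff, Finset.mem_singleton] at hj
      exact lt_of_le_of_ne (hmax j hj.1) (h j hj.1 hj.2))
    rw [hsum, map_zero] at this
    exact hT i hi (ν.zero_iff.1 this.symm)
  obtain ⟨j, hj, hji, hval⟩ := hj
  have key : ∀ i j : ℕ, i ∈ p.support → j ∈ p.support → i < j → ν (T j) = ν (T i) →
      ∃ n : ℕ, 0 < n ∧ ∃ a : M, a ≠ 0 ∧ ν (x ^ n) = ν (algebraMap M L a) := by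
    intro i j hi hj hij hval
    have hi' : p.coeff i ≠ 0 := by simpa using hi
    have hj' : p.coeff j ≠ 0 := by simpa using hj
    refine ⟨j - i, by omega, p.coeff i / p.coeff j, div_ne_zero hi' hj', ?_⟩
    have e : x ^ j = x ^ (j - i) * x ^ i := by rw [← pow_add]; congr 1; omega
    have h1 : ν (algebraMap M L (p.coeff j)) ≠ 0 := by simpa using hj'
    have h2 : ν (x ^ i) ≠ 0 := by simp [hx0]
    simp only [T, e, map_mul] at hval
    rw [map_div₀, map_div₀, eq_div_iff h1]
    refine mul_right_cancel₀ h2 ?_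
    rw [← hval]; ac_rfl
  rcases lt_or_gt_of_ne hji with h | h
  · exact key j i hj hi h hval.symm
  · exact key i j hi hj h hval

/-- A valuation of a field lies under some valuation ring of any extension field. -/
theorem exists_valuationSubring_over {M L : Type*} [Field M] [Field L] [Algebra M L]
    (w : AddValuation M (WithTop Λ)) :
    ∃ O : ValuationSubring L, ∀ a : M, algebraMap M L a ∈ O ↔ 0 ≤ w a := by
  obtain ⟨O, hO, hloc⟩ := IsLocalRing.exists_factor_valuationRing
    ((algebraMap M L).comp (ringOfNonneg w).subtype)
  have h1 : ∀ a : M, 0 ≤ w a → algebraMap M L a ∈ O := fun a ha => hO ⟨a, ha⟩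
  refine ⟨O, fun a => ⟨fun ha => ?_, h1 a⟩⟩
  by_contra hlt
  have ha0 : a ≠ 0 := by rintro rfl; simp at hlt
  have hinv : a⁻¹ ∈ ringOfNonneg w := ((ringOfNonneg w).mem_or_inv_mem a).resolve_left hlt
  -- If `a` lies in `O` but has negative value, then `a⁻¹` becomes a unit of `O`. As `O` dominates
  -- the ring of `w`, it was already a unit there, a contradiction.
  have hu : IsUnit ((((algebraMap M L).comp (ringOfNonneg w).subtype).codRestrict
      O.toSubring hO) ⟨a⁻¹, hinv⟩) := by
    refine IsUnit.of_mul_eq_one ⟨algebraMap M L a, ha⟩ ?_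
    ext
    simp [ha0]
  have hu' := hloc.map_nonunit _ hu
  obtain ⟨b, hb⟩ := hu'.exists_right_inv
  have : (b : M) = a := by
    have := congrArg Subtype.val hb
    simp only [MulMemClass.coe_mul, OneMemClass.coe_one] at this
    field_simp at this
    exact this
  exact hlt (this ▸ b.2)

theorem valuation_le_iff_of_over {M L : Type*} [Field M] [Field L] [Algebra M L]
    {w : AddValuation M (WithTop Λ)} {O : ValuationSubring L}
    (hO : ∀ a : M, algebraMap M L a ∈ O ↔ 0 ≤ w a) {a b : M} (hb : b ≠ 0) :
    O.valuation (algebraMap M L a) ≤ O.valuation (algebraMap M L b) ↔ w b ≤ w a := by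
  have hb' : O.valuation (algebraMap M L b) ≠ 0 := by simpa using hb
  rw [← map_div_nonneg_iff w hb, ← hO, ← O.valuation_le_one_iff, map_div₀, map_div₀,
    div_le_one₀ (zero_lt_iff.2 hb')]

/-- Two valuations of an algebraic extension of `M` which agree on `M` and have the same valuation
ring are equal. -/
theorem eq_of_ringOfNonneg_eq {M L : Type*} [Field M] [Field L] [Algebra M L]
    [Algebra.IsAlgebraic M L] {w₁ w₂ : AddValuation L (WithTop Λ)}
    (h : ∀ a : M, w₁ (algebraMap M L a) = w₂ (algebraMap M L a))
    (hO : ringOfNonneg w₁ = ringOfNonneg w₂) : w₁ = w₂ := by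
  ext x
  rcases eq_or_ne x 0 with rfl | hx
  · simp
  obtain ⟨n, hn, a, ha, hxa⟩ := exists_pow_valuation_eq (M := M) (ringOfNonneg w₁).valuation hx
    (Algebra.IsAlgebraic.isAlgebraic x)
  have key : ∀ w : AddValuation L (WithTop Λ), ringOfNonneg w₁ = ringOfNonneg w →
      n • w x = w (algebraMap M L a) := by
    intro w hw
    rw [hw] at hxa
    have hL : ∀ y : L, (algebraMap L L) y ∈ ringOfNonneg w ↔ 0 ≤ w y := fun y => Iff.rfl
    rw [← w.map_pow]
    apply le_antisymm
    · exact (valuation_le_iff_of_over hL (pow_ne_zero n hx)).1 hxa.ge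
    · exact (valuation_le_iff_of_over hL (by simpa using ha)).1 hxa.le
  have e : n • w₁ x = n • w₂ x := by rw [key w₁ rfl, key w₂ hO, h]
  have h1 : w₁ x ≠ ⊤ := w₁.ne_top_iff.2 hx
  have h2 : w₂ x ≠ ⊤ := w₂.ne_top_iff.2 hx
  lift w₁ x to Λ using h1 with b
  lift w₂ x to Λ using h2 with c
  norm_cast at e ⊢
  exact nsmul_right_injective hn.ne' e

/-- Over a henselian field the extension of the valuation to the algebraic closure is unique. -/
theorem IsHenselian.eq_of_extends {K : Type u} [Field K] {v : AddValuation K (WithTop Λ)}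
    (hv : IsHenselian v) {w₁ w₂ : AddValuation (AlgebraicClosure K) (WithTop Λ)}
    (h₁ : ∀ a : K, w₁ (algebraMap K (AlgebraicClosure K) a) = v a)
    (h₂ : ∀ a : K, w₂ (algebraMap K (AlgebraicClosure K) a) = v a) : w₁ = w₂ := by
  refine eq_of_ringOfNonneg_eq (M := K) (fun a => by rw [h₁, h₂]) (hv.unique ?_ ?_)
  · intro a; rw [mem_ringOfNonneg, h₁]
  · intro a; rw [mem_ringOfNonneg, h₂]

theorem IsHenselian.map_algEquiv {K : Type u} [Field K] {v : AddValuation K (WithTop Λ)}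
    (hv : IsHenselian v) {w : AddValuation (AlgebraicClosure K) (WithTop Λ)}
    (hw : ∀ a : K, w (algebraMap K (AlgebraicClosure K) a) = v a)
    (σ : AlgebraicClosure K ≃ₐ[K] AlgebraicClosure K) (x : AlgebraicClosure K) :
    w (σ x) = w x := by
  have : w.comap (σ : AlgebraicClosure K →+* AlgebraicClosure K) = w :=
    hv.eq_of_extends (fun a => by
      change w (σ (algebraMap K (AlgebraicClosure K) a)) = _
      rw [σ.commutes, hw]) hw
  exact congrArg (fun ν : AddValuation (AlgebraicClosure K) (WithTop Λ) => ν x) this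

/-- The value `l` is attached to `x` by a valuation ring `O` above the valuation `w`: some power
`x ^ n` is equivalent to an element of value `n • l` of the base field. -/
def HasValue {M L : Type*} [Field M] [Field L] [Algebra M L] (w : AddValuation M (WithTop Λ))
    (O : ValuationSubring L) (x : L) (l : Λ) : Prop :=
  ∃ n : ℕ, 0 < n ∧ ∃ a : M, a ≠ 0 ∧ O.valuation (x ^ n) = O.valuation (algebraMap M L a) ∧
    w a = ((n • l : Λ) : WithTop Λ)

variable {M L : Type*} [Field M] [Field L] [Algebra M L] {w : AddValuation M (WithTop Λ)}
  {O : ValuationSubring L}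

theorem exists_hasValue [Module ℚ Λ] [Algebra.IsAlgebraic M L] {x : L} (hx : x ≠ 0) :
    ∃ l, HasValue w O x l := by
  obtain ⟨n, hn, a, ha, h⟩ := exists_pow_valuation_eq (M := M) O.valuation hx
    (Algebra.IsAlgebraic.isAlgebraic x)
  have ha' : w a ≠ ⊤ := w.ne_top_iff.2 ha
  obtain ⟨b, hb⟩ := WithTop.ne_top_iff_exists.1 ha'
  refine ⟨(n : ℚ)⁻¹ • b, n, hn, a, ha, h, ?_⟩
  rw [← hb, ← Nat.cast_smul_eq_nsmul ℚ, smul_smul, mul_inv_cancel₀ (by positivity), one_smul]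

theorem hasValue_algebraMap {a : M} {l : Λ} (ha : w a = l) :
    HasValue w O (algebraMap M L a) l :=
  ⟨1, one_pos, a, w.ne_top_iff.1 (by simp [ha]), by simp, by simpa using ha⟩

theorem HasValue.mul {x y : L} {l m : Λ} (hx : HasValue w O x l) (hy : HasValue w O y m) :
    HasValue w O (x * y) (l + m) := by
  obtain ⟨n, hn, a, ha, h1, h2⟩ := hx
  obtain ⟨k, hk, b, hb, h3, h4⟩ := hy
  refine ⟨n * k, by positivity, a ^ k * b ^ n,
    mul_ne_zero (pow_ne_zero _ ha) (pow_ne_zero _ hb), ?_, ?_⟩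
  · simp only [map_pow, map_mul] at h1 h3 ⊢
    rw [← h1, ← h3, mul_pow, ← pow_mul, ← pow_mul, mul_comm k n]
  · rw [w.map_mul, w.map_pow, w.map_pow, h2, h4]
    norm_cast
    simp only [smul_add, mul_smul, smul_comm k n l]

/-- Raising both elements to the common power `n * k` moves the comparison down to `M`. This gives
at once the uniqueness of the attached value and the ultrametric inequality for the extension. -/
theorem HasValue.le_iff (hO : ∀ a : M, algebraMap M L a ∈ O ↔ 0 ≤ w a) {x y : L} {l m : Λ}
    (hx : HasValue w O x l) (hy : HasValue w O y m) :
    O.valuation y ≤ O.valuation x ↔ l ≤ m := by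
  obtain ⟨n, hn, a, ha, h1, h2⟩ := hx
  obtain ⟨k, hk, b, hb, h3, h4⟩ := hy
  have hnk : n * k ≠ 0 := by positivity
  have ex : O.valuation x ^ (n * k) = O.valuation (algebraMap M L (a ^ k)) := by
    rw [pow_mul, ← map_pow, h1, map_pow, map_pow]
  have ey : O.valuation y ^ (n * k) = O.valuation (algebraMap M L (b ^ n)) := by
    rw [mul_comm, pow_mul, ← map_pow, h3, map_pow, map_pow]
  rw [← pow_le_pow_iff_left₀ zero_le zero_le hnk, ex, ey,
    valuation_le_iff_of_over hO (pow_ne_zero k ha), w.map_pow, w.map_pow, h2, h4]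
  norm_cast
  rw [smul_smul, smul_smul, mul_comm n k]
  exact nsmul_le_nsmul_iff_right (by positivity)

/-- A valuation with values in a divisible group extends to any algebraic extension, with values in
the same group. -/
theorem exists_addValuation_extends [Module ℚ Λ] [Algebra.IsAlgebraic M L]
    (w : AddValuation M (WithTop Λ)) :
    ∃ W : AddValuation L (WithTop Λ), ∀ a : M, W (algebraMap M L a) = w a := by
  classical
  obtain ⟨O, hO⟩ := exists_valuationSubring_over (L := L) w
  have hex : ∀ x : L, ∃ l : Λ, x ≠ 0 → HasValue w O x l := fun x => by
    rcases eq_or_ne x 0 with rfl | hx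
    · exact ⟨0, fun h => absurd rfl h⟩
    · obtain ⟨l, hl⟩ := exists_hasValue (w := w) (O := O) hx
      exact ⟨l, fun _ => hl⟩
  choose e he using hex
  have huniq : ∀ {x : L} {l : Λ}, x ≠ 0 → HasValue w O x l → e x = l := fun hx hl =>
    le_antisymm (((he _ hx).le_iff hO hl).1 le_rfl) ((hl.le_iff hO (he _ hx)).1 le_rfl)
  let f : L → WithTop Λ := fun x => if x = 0 then ⊤ else (e x : WithTop Λ)
  have f0 : f 0 = ⊤ := if_pos rfl
  have fne : ∀ {x}, x ≠ 0 → f x = e x := fun hx => if_neg hx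
  have falg : ∀ a : M, f (algebraMap M L a) = w a := fun a => by
    rcases eq_or_ne a 0 with rfl | ha
    · simp [f0]
    · obtain ⟨b, hb⟩ := WithTop.ne_top_iff_exists.1 (w.ne_top_iff.2 ha)
      have ha' : algebraMap M L a ≠ 0 := by simpa using ha
      rw [fne ha', huniq ha' (hasValue_algebraMap hb.symm), hb]
  refine ⟨AddValuation.of f f0 (by simpa using falg 1) ?_ ?_, falg⟩
  · intro x y
    rcases eq_or_ne x 0 with rfl | hx
    · simp
    rcases eq_or_ne y 0 with rfl | hy
    · simp
    rcases eq_or_ne (x + y) 0 with hxy | hxy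
    · simp [hxy, f0]
    rw [fne hx, fne hy, fne hxy]
    rcases le_max_iff.1 (O.valuation.map_add x y) with h | h
    · exact min_le_of_left_le (WithTop.coe_le_coe.2 (((he x hx).le_iff hO (he _ hxy)).1 h))
    · exact min_le_of_right_le (WithTop.coe_le_coe.2 (((he y hy).le_iff hO (he _ hxy)).1 h))
  · intro x y
    rcases eq_or_ne x 0 with rfl | hx
    · simp [f0]
    rcases eq_or_ne y 0 with rfl | hy
    · simp [f0]
    rw [fne hx, fne hy, fne (mul_ne_zero hx hy),
      huniq (mul_ne_zero hx hy) ((he x hx).mul (he y hy)), WithTop.coe_add]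

/-- A valuation on `K[x]` with trivial support extends to the polynomials over the algebraic
closure, compatibly with the extension of the valuation of a henselian base field. -/
theorem IsHenselian.exists_extension_polynomial [Module ℚ Λ] {K : Type u} [Field K]
    {v : AddValuation K (WithTop Λ)} (hv : IsHenselian v)
    {vbar : AddValuation (AlgebraicClosure K) (WithTop Λ)}
    (hvbar : ∀ a : K, vbar (algebraMap K (AlgebraicClosure K) a) = v a)
    {μ : AddValuation K[X] (WithTop Λ)} (hμ : IsNode v μ) (hsupp : ∀ f, μ f = ⊤ → f = 0) :
    ∃ ν : AddValuation (AlgebraicClosure K)[X] (WithTop Λ), (∀ a, ν (C a) = vbar a) ∧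
      ∀ f : K[X], ν (f.map (algebraMap K (AlgebraicClosure K))) = μ f := by
  have hS : nonZeroDivisors K[X] ≤ (AddValuation.toValuation μ).supp.primeCompl := by
    intro f hf hf'
    exact nonZeroDivisors.ne_zero hf (hsupp f hf')
  let w : AddValuation (FractionRing K[X]) (WithTop Λ) :=
    AddValuation.ofValuation
      ((AddValuation.toValuation μ).extendToLocalization hS (FractionRing K[X]))
  have hw : ∀ f : K[X], w (algebraMap K[X] (FractionRing K[X]) f) = μ f := fun f =>
    (AddValuation.toValuation μ).extendToLocalization_apply_map_apply hS (FractionRing K[X]) f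
  let Ω := AlgebraicClosure (FractionRing K[X])
  obtain ⟨W, hW⟩ := exists_addValuation_extends (L := Ω) w
  let ι : AlgebraicClosure K →ₐ[K] Ω := IsAlgClosed.lift
  let j : K[X] →+* Ω := (algebraMap (FractionRing K[X]) Ω).comp
    (algebraMap K[X] (FractionRing K[X]))
  have hj : ∀ f, W (j f) = μ f := fun f => (hW _).trans (hw f)
  have hιj : ∀ a : K, ι (algebraMap K (AlgebraicClosure K) a) = j (C a) := fun a => by
    rw [ι.commutes, IsScalarTower.algebraMap_apply K (FractionRing K[X]) Ω,
      IsScalarTower.algebraMap_apply K K[X] (FractionRing K[X])]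
    rfl
  -- The extension `W` was arbitrary; henselianity is what makes it compatible with `vbar`.
  have hι : W.comap ι.toRingHom = vbar := hv.eq_of_extends (fun a => by
    change W (ι _) = _
    rw [hιj, hj, hμ]) hvbar
  refine ⟨W.comap (eval₂RingHom ι.toRingHom (j X)), fun a => ?_, fun f => ?_⟩
  · rw [← hι]
    change W (eval₂ ι.toRingHom (j X) (C a)) = W (ι a)
    rw [eval₂_C]; rfl
  · change W (eval₂ ι.toRingHom (j X) (f.map _)) = _
    rw [eval₂_map, ← hj f]
    congr 1
    have : (eval₂RingHom (ι.toRingHom.comp (algebraMap K (AlgebraicClosure K))) (j X)) = j := by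
      ext a
      · simpa using hιj a
      · simp
    exact congrArg (fun g : K[X] →+* Ω => g f) this

end Extension

/-! ### Key polynomials and `φ`-expansions -/

section KeyPolynomial

variable {K : Type u} [Field K]
variable {Λ : Type w} [AddCommGroup Λ] [LinearOrder Λ] [IsOrderedAddMonoid Λ]
variable {μ : AddValuation K[X] (WithTop Λ)}

theorem initialTerm_eq_of {g : K[X]} {α : Λ} (h : μ g = α) :
    initialTerm μ g = DirectSum.of (Piece μ) α (Piece.mk μ α g h.ge) := by
  have hg : μ g ≠ ⊤ := by simp [h]
  have e : (μ g).untop hg = α := by simp [h]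
  rw [initialTerm, dif_neg hg]
  subst e
  rfl

theorem initialTerm_eq_zero_iff {g : K[X]} : initialTerm μ g = 0 ↔ μ g = ⊤ := by
  refine ⟨fun h => ?_, fun h => by rw [initialTerm, dif_pos h]⟩
  by_contra hg
  obtain ⟨α, hα⟩ := WithTop.ne_top_iff_exists.1 hg
  rw [initialTerm_eq_of hα.symm] at h
  have h1 := congrArg (fun G : GradedAlg μ => G α) h
  simp only [DirectSum.of_eq_same, DirectSum.zero_apply] at h1
  rw [Piece.zero_eq_mk, Piece.mk_eq_iff, zero_sub, μ.map_neg, hα] at h1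
  exact lt_irrefl _ h1

theorem initialTerm_mul (f g : K[X]) :
    initialTerm μ (f * g) = initialTerm μ f * initialTerm μ g := by
  by_cases hf : μ f = ⊤
  · rw [initialTerm_eq_zero_iff.2 hf, zero_mul, initialTerm_eq_zero_iff, μ.map_mul, hf, top_add]
  by_cases hg : μ g = ⊤
  · rw [initialTerm_eq_zero_iff.2 hg, mul_zero, initialTerm_eq_zero_iff, μ.map_mul, hg, add_top]
  obtain ⟨α, hα⟩ := WithTop.ne_top_iff_exists.1 hf
  obtain ⟨β, hβ⟩ := WithTop.ne_top_iff_exists.1 hg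
  rw [initialTerm_eq_of hα.symm, initialTerm_eq_of hβ.symm, DirectSum.of_mul_of,
    Piece.mk_mul_mk]
  exact initialTerm_eq_of (by rw [μ.map_mul, ← hα, ← hβ, WithTop.coe_add])

theorem initialTerm_one : initialTerm μ 1 = 1 :=
  initialTerm_eq_of (α := 0) (by simp)

theorem muEquiv_of_lt {f g : K[X]} (h : μ f < μ (g - f)) : MuEquiv μ f g := by
  have hg : μ g = μ f := μ.map_eq_of_lt_sub h
  obtain ⟨α, hα⟩ := WithTop.ne_top_iff_exists.1 h.ne_top
  rw [MuEquiv, initialTerm_eq_of hα.symm, initialTerm_eq_of (hg.trans hα.symm)]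
  congr 1
  rwa [Piece.mk_eq_iff, hα]

theorem muDvd_of_lt {φ f q : K[X]} (h : μ f < μ (f - φ * q)) : MuDvd μ φ f := by
  rw [μ.map_sub_swap] at h
  have h1 : initialTerm μ f = initialTerm μ (φ * q) := muEquiv_of_lt h
  exact ⟨initialTerm μ q, by rw [h1, initialTerm_mul]⟩

/-- The cofactor `G` need not be homogeneous. Only the component of `in φ · G` in degree `μ(f)`
matters, and it is the class of some `φ q`. -/
theorem MuDvd.exists_lt {φ f : K[X]} (hφ : μ φ ≠ ⊤) (hf : μ f ≠ ⊤) (h : MuDvd μ φ f) :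
    ∃ q, μ f < μ (f - φ * q) := by
  obtain ⟨G, hG⟩ := h
  obtain ⟨α, hα⟩ := WithTop.ne_top_iff_exists.1 hφ
  obtain ⟨β, hβ⟩ := WithTop.ne_top_iff_exists.1 hf
  have key : ∃ (q : K[X]) (hq : (β : WithTop Λ) ≤ μ (φ * q)),
      (initialTerm μ φ * G) β = Piece.mk μ β (φ * q) hq := by
    clear hG
    induction G using DirectSum.induction_on with
    | zero => exact ⟨0, by simp, by simp [Piece.zero_eq_mk]⟩
    | of i x =>
      obtain ⟨g, hg, rfl⟩ := Piece.exists_mk μ x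
      rw [initialTerm_eq_of hα.symm, DirectSum.of_mul_of, Piece.mk_mul_mk]
      rcases eq_or_ne β (α + i) with rfl | hne
      · exact ⟨g, le_map_mul μ hα.le hg, by rw [DirectSum.of_eq_same]⟩
      · exact ⟨0, by simp, by rw [DirectSum.of_eq_of_ne _ _ _ hne]; simp [Piece.zero_eq_mk]⟩
    | add x y hx hy =>
      obtain ⟨q, hq, h1⟩ := hx
      obtain ⟨r, hr, h2⟩ := hy
      refine ⟨q + r, by rw [mul_add]; exact μ.map_le_add hq hr, ?_⟩
      rw [mul_add, DirectSum.add_apply, h1, h2, Piece.mk_add_mk]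
      simp only [mul_add]
  obtain ⟨q, hq, h1⟩ := key
  rw [← hG, initialTerm_eq_of hβ.symm, DirectSum.of_eq_same, Piece.mk_eq_iff,
    μ.map_sub_swap] at h1
  exact ⟨q, by rwa [← hβ]⟩

namespace IsKeyPolynomial

variable {φ : K[X]}

theorem map_ne_top (hφ : IsKeyPolynomial μ φ) : μ φ ≠ ⊤ := by
  intro h
  apply hφ.irreducible.1
  rw [initialTerm_eq_zero_iff.2 h, Ideal.span_singleton_eq_bot]

theorem ne_one (hφ : IsKeyPolynomial μ φ) : φ ≠ 1 := by
  rintro rfl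
  apply hφ.irreducible.2.ne_top
  rw [initialTerm_one, Ideal.span_singleton_one]

theorem natDegree_pos (hφ : IsKeyPolynomial μ φ) : 0 < φ.natDegree :=
  Nat.pos_of_ne_zero fun h => hφ.ne_one (hφ.monic.natDegree_eq_zero.1 h)

theorem muDvd_or_muDvd (hφ : IsKeyPolynomial μ φ)
    {f g : K[X]} (h : MuDvd μ φ (f * g)) : MuDvd μ φ f ∨ MuDvd μ φ g := by
  have hp := hφ.irreducible.2.mem_or_mem (x := initialTerm μ f) (y := initialTerm μ g)
    (by rw [← initialTerm_mul]; exact Ideal.mem_span_singleton.2 h)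
  rwa [Ideal.mem_span_singleton, Ideal.mem_span_singleton] at hp

theorem irreducible_polynomial (hφ : IsKeyPolynomial μ φ) : Irreducible φ := by
  rw [hφ.monic.irreducible_iff_natDegree]
  refine ⟨hφ.ne_one, fun f g hf hg hfg => ?_⟩
  have hdeg : f.natDegree + g.natDegree = φ.natDegree := by rw [← hfg, hf.natDegree_mul hg]
  have key : ∀ p : K[X], p.Monic → MuDvd μ φ p → φ.natDegree ≤ p.natDegree := fun p hp h => by
    by_contra! hlt
    exact hφ.minimal p hp.ne_zero (degree_lt_degree hlt) h
  rcases hφ.muDvd_or_muDvd (f := f) (g := g) (by rw [hfg]; exact dvd_rfl) with h | h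
  · right; have := key f hf h; omega
  · left; have := key g hg h; omega

theorem map_ne_top_of_degree_lt (hφ : IsKeyPolynomial μ φ)
    {f : K[X]} (hf : f ≠ 0) (hdeg : f.degree < φ.degree) :
    μ f ≠ ⊤ := by
  intro h
  refine hφ.minimal f hf hdeg ?_
  rw [MuDvd, initialTerm_eq_zero_iff.2 h]
  exact dvd_zero _

/-- Otherwise the remainder would be `μ`-equivalent to a multiple of `φ`, against minimality. -/
theorem map_le_map_modByMonic (hφ : IsKeyPolynomial μ φ) (f : K[X]) : μ f ≤ μ (f %ₘ φ) := by
  by_contra! hlt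
  have h0 : f %ₘ φ ≠ 0 := by rintro h; simp [h] at hlt
  refine hφ.minimal _ h0 (degree_modByMonic_lt f hφ.monic) (muDvd_of_lt (q := -(f /ₘ φ)) ?_)
  rwa [mul_neg, sub_neg_eq_add, modByMonic_add_div]

/-- The remainder modulo `φ` also has infinite value, so its initial term `0` is divisible by `in φ`
and minimality makes it vanish. Since `μ(φ)` is finite, the quotient has infinite value, and the
degree descends. -/
theorem eq_zero_of_map_eq_top (hφ : IsKeyPolynomial μ φ) {f : K[X]} (hf : μ f = ⊤) : f = 0 := by
  induction hn : f.natDegree using Nat.strong_induction_on generalizing f with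
  | _ n ih =>
    have hr : f %ₘ φ = 0 := by
      by_contra h
      refine hφ.map_ne_top_of_degree_lt h (degree_modByMonic_lt f hφ.monic) ?_
      exact top_unique (hf ▸ hφ.map_le_map_modByMonic f)
    have hfq : φ * (f /ₘ φ) = f := by simpa [hr] using modByMonic_add_div f φ
    by_cases hd : f.natDegree < φ.natDegree
    · rw [← hfq, (divByMonic_eq_zero_iff hφ.monic).2 (degree_lt_degree hd), mul_zero]
    have hq : μ (f /ₘ φ) = ⊤ := by
      rw [← hfq, μ.map_mul, WithTop.add_eq_top] at hf
      exact hf.resolve_left hφ.map_ne_top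
    have hpos := hφ.natDegree_pos
    have := ih _ (by rw [natDegree_divByMonic f hφ.monic]; omega) hq rfl
    rw [← hfq, this, mul_zero]

theorem map_ne_top_of_ne_zero (hφ : IsKeyPolynomial μ φ) {f : K[X]} (hf : f ≠ 0) : μ f ≠ ⊤ :=
  fun h => hf (hφ.eq_zero_of_map_eq_top h)

theorem muDvd_iff (hφ : IsKeyPolynomial μ φ)
    {f : K[X]} (hf : f ≠ 0) : MuDvd μ φ f ↔ μ f < μ (f %ₘ φ) := by
  constructor
  · intro h
    obtain ⟨q, hq⟩ := h.exists_lt hφ.map_ne_top (hφ.map_ne_top_of_ne_zero hf)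
    have e : f %ₘ φ = (f - φ * q) %ₘ φ := by
      rw [sub_modByMonic, (modByMonic_eq_zero_iff_dvd hφ.monic).2 (dvd_mul_right φ q), sub_zero]
    rw [e]
    exact hq.trans_le (hφ.map_le_map_modByMonic _)
  · intro h
    refine muDvd_of_lt (q := f /ₘ φ) ?_
    rwa [sub_eq_of_eq_add (modByMonic_add_div f φ).symm]

end IsKeyPolynomial

theorem divByMonic_pow_succ {φ : K[X]} (hφ : φ.Monic) (f : K[X]) (s : ℕ) :
    f /ₘ φ ^ (s + 1) = (f /ₘ φ ^ s) /ₘ φ := by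
  refine (div_modByMonic_unique _ (f %ₘ φ ^ s + φ ^ s * ((f /ₘ φ ^ s) %ₘ φ)) (hφ.pow _)
    ⟨?_, ?_⟩).1
  · have h1 := modByMonic_add_div f (φ ^ s)
    have h2 := modByMonic_add_div (f /ₘ φ ^ s) φ
    conv_rhs => rw [← h1, ← h2]
    ring
  · refine (degree_add_le _ _).trans_lt (max_lt ?_ ?_)
    · refine (degree_modByMonic_lt f (hφ.pow s)).trans_le ?_
      rw [pow_succ, degree_mul]
      exact le_add_of_nonneg_right (zero_le_degree_iff.2 hφ.ne_zero)
    · rw [pow_succ, degree_mul, degree_mul]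
      exact WithBot.add_lt_add_left (degree_ne_bot.2 (hφ.pow s).ne_zero)
        (degree_modByMonic_lt _ hφ)

theorem degree_expansionCoeff_lt {φ : K[X]} (hφ : φ.Monic) (f : K[X]) (s : ℕ) :
    (expansionCoeff φ f s).degree < φ.degree :=
  degree_modByMonic_lt _ hφ

theorem sum_expansionCoeff_mul_pow {φ : K[X]} (hφ : φ.Monic) (f : K[X]) (n : ℕ) :
    ∑ s ∈ Finset.range n, expansionCoeff φ f s * φ ^ s + f /ₘ φ ^ n * φ ^ n = f := by
  induction n with
  | zero => simp
  | succ n ih =>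
    conv_rhs => rw [← ih]
    rw [Finset.sum_range_succ, divByMonic_pow_succ hφ, expansionCoeff]
    conv_rhs => rw [← modByMonic_add_div (f /ₘ φ ^ n) φ]
    ring

/-- If each quotient `f /ₘ φ ^ s` has value at most that of its remainder modulo `φ`, then each
term of the `φ`-expansion of `f` has value at least that of `f`. -/
theorem map_le_map_divByMonic_pow_mul {φ : K[X]} (hφ : φ.Monic) {ω : AddValuation K[X] (WithTop Λ)}
    {f : K[X]} (hω : ∀ s, ω (f /ₘ φ ^ s) ≤ ω (expansionCoeff φ f s)) (s : ℕ) :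
    ω f ≤ ω (f /ₘ φ ^ s * φ ^ s) := by
  induction s with
  | zero => simp
  | succ s ih =>
    refine ih.trans ?_
    have h : ω (f /ₘ φ ^ s) ≤ ω (φ * (f /ₘ φ ^ (s + 1))) := by
      rw [divByMonic_pow_succ hφ]
      have e : φ * (f /ₘ φ ^ s /ₘ φ) = f /ₘ φ ^ s - (f /ₘ φ ^ s) %ₘ φ := by
        rw [eq_sub_iff_add_eq', modByMonic_add_div]
      rw [e]
      exact ω.map_le_sub le_rfl (hω s)
    have e : f /ₘ φ ^ (s + 1) * φ ^ (s + 1) = φ * (f /ₘ φ ^ (s + 1)) * φ ^ s := by ring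
    rw [e, ω.map_mul, ω.map_mul]
    gcongr

theorem map_le_map_expansionCoeff_mul {φ : K[X]} (hφ : φ.Monic)
    {ω : AddValuation K[X] (WithTop Λ)}
    {f : K[X]} (hω : ∀ s, ω (f /ₘ φ ^ s) ≤ ω (expansionCoeff φ f s)) (s : ℕ) :
    ω f ≤ ω (expansionCoeff φ f s * φ ^ s) := by
  refine (map_le_map_divByMonic_pow_mul hφ hω s).trans ?_
  rw [ω.map_mul, ω.map_mul]
  gcongr
  exact hω s

/-- Key polynomials have maximal weighted value. -/
theorem IsKeyPolynomial.natDegree_nsmul_map_le {φ : K[X]} (hφ : IsKeyPolynomial μ φ) {f : K[X]}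
    (hf : f.Monic) : φ.natDegree • μ f ≤ f.natDegree • μ φ := by
  -- The power makes the degree equal to that of `φ ^ f.natDegree`, which is then the top term of
  -- the expansion, with coefficient `1`.
  have h := map_le_map_divByMonic_pow_mul hφ.monic (ω := μ) (f := f ^ φ.natDegree)
    (fun s => hφ.map_le_map_modByMonic _) f.natDegree
  have hdeg : (f ^ φ.natDegree).natDegree = (φ ^ f.natDegree).natDegree := by
    rw [natDegree_pow, natDegree_pow, mul_comm]
  have e : f ^ φ.natDegree /ₘ φ ^ f.natDegree = 1 := by
    have hm : (f ^ φ.natDegree /ₘ φ ^ f.natDegree).Monic := by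
      rw [Monic, leadingCoeff_divByMonic_of_monic (hφ.monic.pow _)
        (by rw [degree_eq_natDegree (hf.pow _).ne_zero,
          degree_eq_natDegree (hφ.monic.pow _).ne_zero, hdeg]), (hf.pow _).leadingCoeff]
    refine hm.natDegree_eq_zero.1 ?_
    rw [natDegree_divByMonic _ (hφ.monic.pow _), hdeg, Nat.sub_self]
  rwa [e, one_mul, μ.map_pow, μ.map_pow] at h

end KeyPolynomial

/-! ### Sums and products of values -/

section Sums

variable {Λ : Type w} [AddCommGroup Λ] [LinearOrder Λ] [IsOrderedAddMonoid Λ]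

theorem sum_map_lt_sum_map_of_ne_top {ι : Type*} {m : Multiset ι} {f g : ι → WithTop Λ}
    (hle : ∀ i ∈ m, f i ≤ g i) {i : ι} (hi : i ∈ m) (hlt : f i < g i)
    (hf : (m.map f).sum ≠ ⊤) : (m.map f).sum < (m.map g).sum := by
  obtain ⟨m', rfl⟩ := Multiset.exists_cons_of_mem hi
  simp only [Multiset.map_cons, Multiset.sum_cons] at hf ⊢
  refine WithTop.add_lt_add_of_lt_of_le (fun h => hf (by simp [h])) hlt
    (Multiset.sum_map_le_sum_map _ _ fun j hj => hle j (Multiset.mem_cons_of_mem hj))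

theorem addValuation_multiset_prod {R : Type*} [CommRing R] (ω : AddValuation R (WithTop Λ))
    (m : Multiset R) : ω m.prod = (m.map ω).sum := by
  induction m using Multiset.induction_on with
  | empty => simp
  | cons a m ih => simp [ω.map_mul, ih]

/-- Products of pairwise equivalent elements are equivalent. -/
theorem map_prod_lt_map_prod_sub_prod {ι R : Type*} [CommRing R] (ω : AddValuation R (WithTop Λ))
    (m : Multiset ι) {a b : ι → R} (h : ∀ i ∈ m, ω (a i) < ω (a i - b i)) :
    ω (m.map a).prod < ω ((m.map a).prod - (m.map b).prod) := by
  induction m using Multiset.induction_on with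
  | empty => simp
  | cons i m ih =>
    have h1 := h i (Multiset.mem_cons_self i m)
    have h2 := ih fun j hj => h j (Multiset.mem_cons_of_mem hj)
    simp only [Multiset.map_cons, Multiset.prod_cons]
    set P := (m.map a).prod
    set Q := (m.map b).prod
    have hPQ : ω Q = ω P := ω.map_eq_of_lt_sub (by rwa [ω.map_sub_swap])
    have e : a i * P - b i * Q = a i * (P - Q) + (a i - b i) * Q := by ring
    rw [e]
    refine ω.map_lt_add ?_ ?_
    · rw [ω.map_mul, ω.map_mul]
      exact WithTop.add_lt_add_left h1.ne_top h2
    · rw [ω.map_mul, ω.map_mul, hPQ]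
      exact WithTop.add_lt_add_right h2.ne_top h1

end Sums

/-! ### Values as sums over roots; conjugation -/

section Roots

variable {K : Type u} [Field K] {A : Type*} [Field A] [Algebra K A] [IsAlgClosed A]
variable {Λ : Type w} [AddCommGroup Λ] [LinearOrder Λ] [IsOrderedAddMonoid Λ]

theorem map_eq_C_mul_prod_aroots (f : K[X]) :
    f.map (algebraMap K A) =
      C (algebraMap K A f.leadingCoeff) * ((f.aroots A).map fun β => X - C β).prod := by
  conv_lhs => rw [(IsAlgClosed.splits (f.map (algebraMap K A))).eq_prod_roots,
    leadingCoeff_map]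

theorem addValuation_map_eq_sum (ω : AddValuation A[X] (WithTop Λ)) (f : K[X]) :
    ω (f.map (algebraMap K A)) = ω (C (algebraMap K A f.leadingCoeff)) +
      ((f.aroots A).map fun β => ω (X - C β)).sum := by
  rw [map_eq_C_mul_prod_aroots, ω.map_mul, addValuation_multiset_prod, Multiset.map_map]
  rfl

theorem addValuation_aeval_eq_sum (w : AddValuation A (WithTop Λ)) (t : A) (f : K[X]) :
    w (aeval t f) = w (algebraMap K A f.leadingCoeff) +
      ((f.aroots A).map fun β => w (t - β)).sum := by
  have h := addValuation_map_eq_sum (w.comap (evalRingHom t)) f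
  have e : ∀ g : A[X], w.comap (evalRingHom t) g = w (eval t g) := fun g => rfl
  simpa only [e, eval_C, eval_sub, eval_X, eval_map_algebraMap] using h

theorem addValuation_aeval_eq_sum_of_monic (w : AddValuation A (WithTop Λ)) (t : A) {f : K[X]}
    (hf : f.Monic) : w (aeval t f) = ((f.aroots A).map fun β => w (t - β)).sum := by
  rw [addValuation_aeval_eq_sum, hf.leadingCoeff, map_one, w.map_one, zero_add]

theorem exists_algEquiv_of_irreducible [Algebra.IsAlgebraic K A] {F : K[X]} (hF : Irreducible F)
    {x y : A} (hx : aeval x F = 0) (hy : aeval y F = 0) : ∃ σ : A ≃ₐ[K] A, σ x = y := by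
  have : IsAlgClosure K A := ⟨inferInstance, inferInstance⟩
  have : Normal K A := IsAlgClosure.normal K A
  refine minpoly.exists_algEquiv_of_root' (Algebra.IsAlgebraic.isAlgebraic x) ?_
  rw [← minpoly.eq_of_irreducible hF hx, map_mul, hy, zero_mul]

theorem addValuation_aeval_eq_of_conj [Algebra.IsAlgebraic K A]
    {w : AddValuation A (WithTop Λ)} (hw : ∀ (σ : A ≃ₐ[K] A) x, w (σ x) = w x)
    {F : K[X]} (hF : Irreducible F) {x y : A} (hx : aeval x F = 0) (hy : aeval y F = 0)
    (f : K[X]) : w (aeval x f) = w (aeval y f) := by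
  obtain ⟨σ, rfl⟩ := exists_algEquiv_of_irreducible hF hx hy
  rw [← hw σ, aeval_algHom_apply]

end Roots

/-- `ν` extends both the valuation `μ` of `K[x]` and the valuation `w` of the algebraic closure `A`,
and `w` is invariant under conjugation. -/
structure IsGeometricExtension {K : Type u} [Field K] {A : Type*} [Field A] [Algebra K A]
    {Λ : Type w} [AddCommGroup Λ] [LinearOrder Λ] [IsOrderedAddMonoid Λ]
    (w : AddValuation A (WithTop Λ)) (μ : AddValuation K[X] (WithTop Λ))
    (ν : AddValuation A[X] (WithTop Λ)) : Prop where
  map_C : ∀ a, ν (C a) = w a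
  map_map : ∀ f : K[X], ν (f.map (algebraMap K A)) = μ f
  map_algEquiv : ∀ (σ : A ≃ₐ[K] A) (x : A), w (σ x) = w x

/-- `α` is a root of `φ` which is as close as possible to `x`. -/
structure IsNearestRoot {K : Type u} [Field K] {A : Type*} [Field A] [Algebra K A]
    {Λ : Type w} [AddCommGroup Λ] [LinearOrder Λ] [IsOrderedAddMonoid Λ]
    (ν : AddValuation A[X] (WithTop Λ)) (φ : K[X]) (α : A) : Prop where
  aeval_eq_zero : aeval α φ = 0
  map_le : ∀ β : A, aeval β φ = 0 → ν (X - C β) ≤ ν (X - C α)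

/-! ### The nearest root and the divisibility criterion -/

section Nearest

variable {K : Type u} [Field K] {A : Type*} [Field A] [Algebra K A]
variable {Λ : Type w} [AddCommGroup Λ] [LinearOrder Λ] [IsOrderedAddMonoid Λ]
variable {w : AddValuation A (WithTop Λ)} {μ : AddValuation K[X] (WithTop Λ)}
  {ν : AddValuation A[X] (WithTop Λ)} {φ : K[X]} {α : A}

theorem IsGeometricExtension.map_C_base (h : IsGeometricExtension w μ ν) (a : K) :
    w (algebraMap K A a) = μ (C a) := by
  rw [← h.map_C, ← h.map_map, Polynomial.map_C]

variable [IsAlgClosed A]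

theorem IsKeyPolynomial.exists_isNearestRoot (hφ : IsKeyPolynomial μ φ)
    (ν : AddValuation A[X] (WithTop Λ)) : ∃ α : A, IsNearestRoot ν φ α := by
  classical
  have hdeg : φ.degree ≠ 0 := fun h =>
    hφ.natDegree_pos.ne' (natDegree_eq_of_degree_eq_some h)
  obtain ⟨β, hβ⟩ := IsAlgClosed.exists_aeval_eq_zero A φ hdeg
  have hmem : ∀ γ : A, γ ∈ (φ.aroots A).toFinset ↔ aeval γ φ = 0 := fun γ => by
    rw [Multiset.mem_toFinset, mem_aroots]
    exact and_iff_right hφ.monic.ne_zero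
  obtain ⟨α, hα, hmax⟩ := (φ.aroots A).toFinset.exists_max_image (fun γ => ν (X - C γ))
    ⟨β, (hmem β).2 hβ⟩
  exact ⟨α, (hmem α).1 hα, fun γ hγ => hmax γ ((hmem γ).2 hγ)⟩

namespace IsGeometricExtension

theorem map_eq_sum (h : IsGeometricExtension w μ ν) (f : K[X]) :
    μ f = w (algebraMap K A f.leadingCoeff) + ((f.aroots A).map fun β => ν (X - C β)).sum := by
  rw [← h.map_map, addValuation_map_eq_sum, h.map_C]

theorem map_eq_sum_of_monic (h : IsGeometricExtension w μ ν) {f : K[X]} (hf : f.Monic) :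
    μ f = ((f.aroots A).map fun β => ν (X - C β)).sum := by
  rw [h.map_eq_sum, hf.leadingCoeff, map_one, w.map_one, zero_add]

/-- No point of the algebraic closure is closer to `x` than the nearest root of a key polynomial. -/
theorem map_X_sub_C_le [Algebra.IsAlgebraic K A] (h : IsGeometricExtension w μ ν)
    (hφ : IsKeyPolynomial μ φ) (hα : IsNearestRoot ν φ α) (β : A) :
    ν (X - C β) ≤ ν (X - C α) := by
  by_contra! hlt
  set z : A := aeval β φ with hz
  have hφprod : φ.map (algebraMap K A) = ((φ.aroots A).map fun γ => X - C γ).prod := by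
    rw [map_eq_C_mul_prod_aroots, hφ.monic.leadingCoeff, _root_.map_one, C_1, one_mul]
  have hzprod : C z = ((φ.aroots A).map fun γ => C (β - γ)).prod := by
    rw [hz, ← eval_map_algebraMap, hφprod, eval_multiset_prod, Multiset.map_map,
      map_multiset_prod (C : A →+* A[X]), Multiset.map_map]
    simp
  -- Each factor `x - γ` differs from `β - γ` by `x - β`, of larger value, so `φ` is `ν`-equivalent
  -- to the constant `z = φ(β)`.
  have h1 : ν (φ.map (algebraMap K A)) < ν (φ.map (algebraMap K A) - C z) := by
    rw [hφprod, hzprod]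
    refine map_prod_lt_map_prod_sub_prod ν _ fun γ hγ => ?_
    have e : X - C γ - C (β - γ) = X - C β := by rw [C_sub]; ring
    rw [e]
    exact (hα.map_le γ ((mem_aroots.1 hγ).2)).trans_lt hlt
  have h2 : w z = μ φ := by
    rw [← h.map_C, ← h.map_map]
    exact ν.map_eq_of_lt_sub (by rwa [ν.map_sub_swap])
  rw [h.map_map] at h1
  have hint : IsIntegral K z := Algebra.IsIntegral.isIntegral z
  set P := minpoly K z with hP
  have hPm : P.Monic := minpoly.monic hint
  have hroot : ∀ y ∈ P.aroots A, w y = μ φ := fun y hy => by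
    have := addValuation_aeval_eq_of_conj h.map_algEquiv (minpoly.irreducible hint)
      (mem_aroots.1 hy).2 (minpoly.aeval K z) X
    rwa [aeval_X, aeval_X, h2] at this
  have h3 : μ (C (P.coeff 0)) = ((P.aroots A).map fun y => w y).sum := by
    rw [← h.map_C_base, coeff_zero_eq_aeval_zero',
      addValuation_aeval_eq_sum_of_monic w 0 hPm]
    simp
  have h4 : μ (P.comp φ) = ((P.aroots A).map fun y => ν (φ.map (algebraMap K A) - C y)).sum := by
    rw [← h.map_map, Polynomial.map_comp, map_eq_C_mul_prod_aroots P, hPm.leadingCoeff,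
      _root_.map_one, C_1, one_mul, multiset_prod_comp, addValuation_multiset_prod,
      Multiset.map_map, Multiset.map_map]
    simp
  -- `P(φ)` is the product of `φ - y` over the conjugates `y` of `z`. All factors have value at
  -- least `w y = μ φ`, and the factor at `z` has more.
  have h5 : μ (C (P.coeff 0)) < μ (P.comp φ) := by
    have hzmem : z ∈ P.aroots A := mem_aroots.2 ⟨hPm.ne_zero, minpoly.aeval K z⟩
    have hle : ∀ y ∈ P.aroots A, w y ≤ ν (φ.map (algebraMap K A) - C y) := fun y hy => by
      refine ν.map_le_sub ?_ ?_
      · rw [h.map_map, hroot y hy]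
      · rw [h.map_C]
    rw [h3, h4]
    refine sum_map_lt_sum_map_of_ne_top hle hzmem (by rwa [h2]) ?_
    rw [Multiset.map_congr rfl hroot, Multiset.map_const', Multiset.sum_replicate]
    obtain ⟨b, hb⟩ := WithTop.ne_top_iff_exists.1 hφ.map_ne_top
    rw [← hb, ← WithTop.coe_nsmul]
    exact WithTop.coe_ne_top
  -- So `φ` would `μ`-divide the nonzero constant `P(0)`, contradicting minimality.
  have e : P.comp φ = C (P.coeff 0) - φ * (-(P.divX.comp φ)) := by
    conv_lhs => rw [← P.divX_mul_X_add]
    simp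
    ring
  have hc : P.coeff 0 ≠ 0 := by
    intro hc
    simp [hc] at h5
  refine hφ.minimal (C (P.coeff 0)) (by simpa using hc) ?_ (muDvd_of_lt (e ▸ h5))
  rw [degree_C hc]
  exact natDegree_pos_iff_degree_pos.1 hφ.natDegree_pos

variable [Algebra.IsAlgebraic K A]

/-- Only a tie `ν(x - α) = w(α - β)` could break the formula, and there the maximality of `ν(x - α)`
gives the upper bound. -/
theorem map_X_sub_C_eq_min (h : IsGeometricExtension w μ ν)
    (hφ : IsKeyPolynomial μ φ) (hα : IsNearestRoot ν φ α)
    (β : A) : ν (X - C β) = min (ν (X - C α)) (w (α - β)) := by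
  have e : X - C β = (X - C α) + C (α - β) := by rw [C_sub]; ring
  have hle := h.map_X_sub_C_le hφ hα β
  rcases eq_or_ne (ν (X - C α)) (w (α - β)) with heq | hne
  · refine le_antisymm (le_min hle (heq ▸ hle)) ?_
    rw [e, ← h.map_C]
    exact ν.map_add _ _
  · rw [e, ν.map_add_of_distinct_val (by rwa [h.map_C]), h.map_C]

theorem map_X_sub_C_le_map_sub (h : IsGeometricExtension w μ ν)
    (hφ : IsKeyPolynomial μ φ) (hα : IsNearestRoot ν φ α)
    (β : A) : ν (X - C β) ≤ w (α - β) :=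
  (h.map_X_sub_C_eq_min hφ hα β).trans_le (min_le_right _ _)

theorem map_le_map_aeval (h : IsGeometricExtension w μ ν)
    (hφ : IsKeyPolynomial μ φ) (hα : IsNearestRoot ν φ α)
    (f : K[X]) : μ f ≤ w (aeval α f) := by
  rw [h.map_eq_sum, addValuation_aeval_eq_sum]
  gcongr 1
  exact Multiset.sum_map_le_sum_map _ _ fun β _ => h.map_X_sub_C_le_map_sub hφ hα β

theorem map_lt_map_aeval_iff (h : IsGeometricExtension w μ ν)
    (hφ : IsKeyPolynomial μ φ) (hα : IsNearestRoot ν φ α)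
    {f : K[X]} (hf : f ≠ 0) :
    μ f < w (aeval α f) ↔ ∃ β, aeval β f = 0 ∧ ν (X - C α) < w (α - β) := by
  constructor
  · intro hlt
    by_contra! hle
    refine hlt.ne ?_
    rw [h.map_eq_sum, addValuation_aeval_eq_sum]
    congr 2
    refine Multiset.map_congr rfl fun β hβ => ?_
    rw [h.map_X_sub_C_eq_min hφ hα, min_eq_right (hle β (mem_aroots.1 hβ).2)]
  · rintro ⟨β, hβ, hlt⟩
    have hne := hφ.map_ne_top_of_ne_zero hf
    rw [h.map_eq_sum] at hne ⊢
    rw [WithTop.add_ne_top] at hne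
    rw [addValuation_aeval_eq_sum]
    refine WithTop.add_lt_add_left hne.1 (sum_map_lt_sum_map_of_ne_top
      (fun γ _ => h.map_X_sub_C_le_map_sub hφ hα γ) (mem_aroots.2 ⟨hf, hβ⟩) ?_ hne.2)
    exact (h.map_X_sub_C_le hφ hα β).trans_lt hlt

/-- Let `c₀` be the inverse of `a` modulo `φ`, reduced. By primality `φ` does not `μ`-divide `a c₀`,
so `μ(a) + μ(c₀) ≥ μ(1) = 0`, while `w(a(α)) + w(c₀(α)) = 0`. As `μ` is at most evaluation at `α` on
both factors, equality holds. -/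
theorem map_aeval_eq_of_degree_lt (h : IsGeometricExtension w μ ν)
    (hφ : IsKeyPolynomial μ φ) (hα : IsNearestRoot ν φ α)
    {a : K[X]} (hdeg : a.degree < φ.degree) :
    w (aeval α a) = μ a := by
  rcases eq_or_ne a 0 with rfl | ha
  · simp
  have hcop : IsCoprime φ a := hφ.irreducible_polynomial.coprime_iff_not_dvd.2 fun hdvd =>
    (degree_le_of_dvd hdvd ha).not_gt hdeg
  obtain ⟨u, c, huc⟩ := hcop
  set c₀ := c %ₘ φ with hc₀
  have h1 : (a * c₀) %ₘ φ = 1 := by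
    refine (div_modByMonic_unique (-u - (c /ₘ φ) * a) 1 hφ.monic ⟨?_, ?_⟩).2
    · have := modByMonic_add_div c φ
      rw [← hc₀] at this
      linear_combination huc * (-1 : K[X]) - a * this
    · rw [degree_one]
      exact natDegree_pos_iff_degree_pos.1 hφ.natDegree_pos
  have hc0 : c₀ ≠ 0 := by
    intro h0
    rw [h0, mul_zero, zero_modByMonic] at h1
    exact zero_ne_one h1
  have hnd : ¬ MuDvd μ φ (a * c₀) := fun hd =>
    (hφ.muDvd_or_muDvd hd).elim (hφ.minimal a ha hdeg)
      (hφ.minimal c₀ hc0 (degree_modByMonic_lt c hφ.monic))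
  rw [hφ.muDvd_iff (mul_ne_zero ha hc0), h1, not_lt] at hnd
  have h2 := h.map_le_map_aeval hφ hα a
  have h3 := h.map_le_map_aeval hφ hα c₀
  have h4 : w (aeval α a) + w (aeval α c₀) = 0 := by
    rw [← w.map_mul, ← _root_.map_mul]
    rw [← aeval_modByMonic_eq_self_of_root hα.aeval_eq_zero, h1, _root_.map_one, w.map_one]
  rw [μ.map_one, μ.map_mul] at hnd
  refine le_antisymm ?_ h2
  have h5 : w (aeval α c₀) ≠ ⊤ := by
    intro h5
    simp [h5] at h4
  have h6 : w (aeval α a) + w (aeval α c₀) ≤ μ a + w (aeval α c₀) :=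
    calc _ = 0 := h4
      _ ≤ μ a + μ c₀ := hnd
      _ ≤ _ := by gcongr
  exact (WithTop.add_le_add_iff_right h5).1 h6

theorem map_sub_le_of_degree_lt (h : IsGeometricExtension w μ ν)
    (hφ : IsKeyPolynomial μ φ) (hα : IsNearestRoot ν φ α)
    {a : K[X]} (ha : a ≠ 0) (hdeg : a.degree < φ.degree) {β : A}
    (hβ : aeval β a = 0) : w (α - β) ≤ ν (X - C α) := by
  by_contra! hlt
  exact ((h.map_lt_map_aeval_iff hφ hα ha).2 ⟨β, hβ, hlt⟩).ne'
    (h.map_aeval_eq_of_degree_lt hφ hα hdeg)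

theorem muDvd_iff_exists_close (h : IsGeometricExtension w μ ν)
    (hφ : IsKeyPolynomial μ φ) (hα : IsNearestRoot ν φ α)
    {f : K[X]} (hf : f ≠ 0) :
    MuDvd μ φ f ↔ ∃ β, aeval β f = 0 ∧ ν (X - C α) < w (α - β) := by
  rw [hφ.muDvd_iff hf, ← h.map_lt_map_aeval_iff hφ hα hf,
    ← h.map_aeval_eq_of_degree_lt hφ hα (degree_modByMonic_lt f hφ.monic)]
  rw [aeval_modByMonic_eq_self_of_root hα.aeval_eq_zero]

/-- The point `θ`, among its conjugates, can be chosen such that `α` is the closest root of `φ`. -/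
theorem exists_conj_forall_le (h : IsGeometricExtension w μ ν)
    (hφ : IsKeyPolynomial μ φ) (hα : IsNearestRoot ν φ α)
    {F : K[X]} {θ : A} (hθ : aeval θ F = 0) :
    ∃ θ', aeval θ' F = 0 ∧ ∀ β, aeval β φ = 0 → w (θ' - β) ≤ w (θ' - α) := by
  classical
  have hmem : ∀ γ : A, γ ∈ (φ.aroots A).toFinset ↔ aeval γ φ = 0 := fun γ => by
    rw [Multiset.mem_toFinset, mem_aroots]
    exact and_iff_right hφ.monic.ne_zero
  obtain ⟨β, hβ, hmax⟩ := (φ.aroots A).toFinset.exists_max_image (fun γ => w (θ - γ))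
    ⟨α, (hmem α).2 hα.aeval_eq_zero⟩
  obtain ⟨σ, hσ⟩ := exists_algEquiv_of_irreducible hφ.irreducible_polynomial ((hmem β).1 hβ)
    hα.aeval_eq_zero
  refine ⟨σ θ, by rw [aeval_algHom_apply, hθ, map_zero], fun γ hγ => ?_⟩
  have h1 := hmax (σ.symm γ) ((hmem _).2 (by rw [aeval_algHom_apply, hγ, map_zero]))
  rw [← h.map_algEquiv σ (θ - _), ← h.map_algEquiv σ (θ - β)] at h1
  simpa [hσ] using h1

theorem muDvd_iff_lt (h : IsGeometricExtension w μ ν)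
    (hφ : IsKeyPolynomial μ φ) (hα : IsNearestRoot ν φ α)
    {F : K[X]} (hFm : F.Monic) (hF : Irreducible F) {θ : A}
    (hθ : aeval θ F = 0) : MuDvd μ φ F ↔ μ φ < w (aeval θ φ) := by
  rw [h.muDvd_iff_exists_close hφ hα hFm.ne_zero]
  constructor
  · rintro ⟨β, hβ, hlt⟩
    rw [addValuation_aeval_eq_of_conj h.map_algEquiv hF hθ hβ,
      addValuation_aeval_eq_sum_of_monic w β hφ.monic, h.map_eq_sum_of_monic hφ.monic]
    -- With `β` in the open ball around `α`, each `w(β - γ)` is at least `ν(x - γ)`, strictly at `γ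
    -- = α`.
    have hne := hφ.map_ne_top
    rw [h.map_eq_sum_of_monic hφ.monic] at hne
    refine sum_map_lt_sum_map_of_ne_top (fun γ _ => ?_)
      (mem_aroots.2 ⟨hφ.monic.ne_zero, hα.aeval_eq_zero⟩) (by rwa [w.map_sub_swap]) hne
    have e : β - γ = (α - γ) - (α - β) := by ring
    rw [e]
    exact w.map_le_sub (h.map_X_sub_C_le_map_sub hφ hα γ)
      ((h.map_X_sub_C_le hφ hα γ).trans hlt.le)
  · intro hlt
    by_contra! hle
    -- If no root of `F` lies in the ball, a conjugate having `α` as closest root of `φ` satisfies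
    -- `w(β - γ) ≤ min(δ, w(α - γ))` for every root `γ` of `φ`.
    obtain ⟨β, hβ, hmax⟩ := h.exists_conj_forall_le hφ hα hθ
    refine hlt.not_ge ?_
    rw [addValuation_aeval_eq_of_conj h.map_algEquiv hF hθ hβ,
      addValuation_aeval_eq_sum_of_monic w β hφ.monic, h.map_eq_sum_of_monic hφ.monic]
    refine Multiset.sum_map_le_sum_map _ _ fun γ hγ => ?_
    have h1 := hmax γ (mem_aroots.1 hγ).2
    have h2 := hle β hβ
    rw [w.map_sub_swap] at h2
    rw [h.map_X_sub_C_eq_min hφ hα]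
    refine le_min (h1.trans h2) ?_
    have e : α - γ = (β - γ) - (β - α) := by ring
    rw [e]
    exact w.map_le_sub le_rfl h1

end IsGeometricExtension

end Nearest

/-! ### Convex hulls in `ℚ × Λ` -/

section LowerBoundary

variable {Λ : Type w} [AddCommGroup Λ] [LinearOrder Λ] [IsOrderedAddMonoid Λ] [Module ℚ Λ]

/-- Clearing the denominator reduces this to natural multiples, where compatibility of order and
addition suffices. -/
theorem rat_smul_le_smul {q : ℚ} (hq : 0 ≤ q) {x y : Λ} (hxy : x ≤ y) : q • x ≤ q • y := by
  have key : ∀ z : Λ, q.den • (q • z) = q.num.toNat • z := fun z => by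
    rw [← Nat.cast_smul_eq_nsmul ℚ, ← Nat.cast_smul_eq_nsmul ℚ, smul_smul, mul_comm,
      Rat.mul_den_eq_num]
    congr 1
    exact_mod_cast (Int.toNat_of_nonneg (Rat.num_nonneg.2 hq)).symm
  rw [← nsmul_le_nsmul_iff_right q.den_ne_zero, key, key]
  gcongr

theorem mem_segment_iff_of_slope {Λ : Type*} [AddCommGroup Λ] [Module ℚ Λ] {Y γ : Λ}
    {l : ℕ} (hl : 0 < l) {p : ℚ × Λ} :
    p ∈ segment ℚ ((0 : ℚ), Y) ((l : ℚ), Y + l • (-γ)) ↔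
      0 ≤ p.1 ∧ p.1 ≤ l ∧ p.2 + p.1 • γ = Y := by
  have hl' : (0 : ℚ) < l := by exact_mod_cast hl
  rw [segment_eq_image]
  constructor
  · rintro ⟨t, ⟨h0, h1⟩, rfl⟩
    refine ⟨?_, ?_, ?_⟩
    · simp; positivity
    · simp; nlinarith
    · simp only [Prod.fst_add, Prod.smul_fst, Prod.snd_add, Prod.smul_snd, smul_eq_mul, mul_zero,
        zero_add, ← Nat.cast_smul_eq_nsmul ℚ]
      module
  · rintro ⟨h0, h1, h2⟩
    refine ⟨p.1 / l, ⟨by positivity, (div_le_one hl').2 h1⟩, ?_⟩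
    ext
    · simp; field_simp
    · simp only [Prod.snd_add, Prod.smul_snd, ← Nat.cast_smul_eq_nsmul ℚ]
      rw [← eq_sub_iff_add_eq] at h2
      rw [h2, smul_add, smul_smul, div_mul_cancel₀ _ hl'.ne']
      module

/-- The lower boundary of the convex hull of a set of points lying above the segment that joins two
of them, and over its projection. -/
theorem lowerBoundary_eq_segment {S : Set (ℚ × Λ)} {Y γ : Λ} {l : ℕ} (hl : 0 < l)
    (h0 : ((0 : ℚ), Y) ∈ S) (h1 : ((l : ℚ), Y + l • (-γ)) ∈ S)
    (hS : ∀ p ∈ S, 0 ≤ p.1 ∧ p.1 ≤ l ∧ Y ≤ p.2 + p.1 • γ) :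
    {p : ℚ × Λ | p ∈ convexHull ℚ S ∧ ∀ y : Λ, (p.1, y) ∈ convexHull ℚ S → p.2 ≤ y} =
      segment ℚ ((0 : ℚ), Y) ((l : ℚ), Y + l • (-γ)) := by
  have hseg := segment_subset_convexHull (𝕜 := ℚ) h0 h1
  have hconv : Convex ℚ {p : ℚ × Λ | 0 ≤ p.1 ∧ p.1 ≤ l ∧ Y ≤ p.2 + p.1 • γ} := by
    rintro x ⟨hx0, hx1, hx2⟩ y ⟨hy0, hy1, hy2⟩ a b ha hb hab
    refine ⟨?_, ?_, ?_⟩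
    · simp; positivity
    · simp only [Prod.fst_add, Prod.smul_fst, smul_eq_mul]
      calc a * x.1 + b * y.1 ≤ a * l + b * l := by gcongr
        _ = l := by rw [← add_mul, hab, one_mul]
    · calc Y = a • Y + b • Y := by rw [← add_smul, hab, one_smul]
        _ ≤ a • (x.2 + x.1 • γ) + b • (y.2 + y.1 • γ) :=
          add_le_add (rat_smul_le_smul ha hx2) (rat_smul_le_smul hb hy2)
        _ = _ := by
          simp only [Prod.fst_add, Prod.smul_fst, Prod.snd_add, Prod.smul_snd, smul_eq_mul]
          module
  have hhull := convexHull_min hS hconv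
  ext p
  rw [mem_segment_iff_of_slope hl]
  constructor
  · rintro ⟨hp, hmin⟩
    obtain ⟨hp0, hp1, hp2⟩ := hhull hp
    refine ⟨hp0, hp1, le_antisymm ?_ hp2⟩
    have := hmin (Y - p.1 • γ) (hseg ((mem_segment_iff_of_slope hl).2
      ⟨hp0, hp1, sub_add_cancel _ _⟩))
    exact le_sub_iff_add_le.1 this
  · rintro ⟨hp0, hp1, hp2⟩
    refine ⟨hseg ((mem_segment_iff_of_slope hl).2 ⟨hp0, hp1, hp2⟩), fun y hy => ?_⟩
    have := (hhull hy).2.2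
    rw [← hp2] at this
    exact le_of_add_le_add_right this

end LowerBoundary

/-! ### Generic points of discs -/

section GenericPoint

variable {A : Type*} [Field A] [IsAlgClosed A]
variable {Λ : Type w} [AddCommGroup Λ] [LinearOrder Λ] [IsOrderedAddMonoid Λ]

/-- A disc of the form `{t | w r ≤ w (α - t)}` has points in general position with respect to any
finite set. -/
theorem exists_generic_point (w : AddValuation A (WithTop Λ)) (α : A) {r : A} (hr : r ≠ 0)
    (B : Finset A) : ∃ t : A, w (α - t) = w r ∧ ∀ β ∈ B, w (t - β) = min (w r) (w (α - β)) := by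
  classical
  set B' := insert α (B.filter fun β => w r ≤ w (α - β)) with hB'
  have hclose : ∀ β ∈ B', w r ≤ w (α - β) := fun β hβ => by
    rcases Finset.mem_insert.1 hβ with rfl | hβ
    · simp
    · exact (Finset.mem_filter.1 hβ).2
  have hcard : 0 < B'.card := Finset.card_pos.2 ⟨α, Finset.mem_insert_self _ _⟩
  have hdeg : degree (∏ β ∈ B', (X - C β)) = (B'.card : WithBot ℕ) := by
    rw [degree_prod]; simp
  -- The equation `∏ (t - β) = r ^ n` over the `n` centres in the disc makes `w r` the average of
  -- the `w (t - β)`. Outside the disc all of these would be equal and below `w r`; inside, none is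
  -- below `w r`, so all equal `w r`.
  obtain ⟨t, ht⟩ := IsAlgClosed.exists_root (∏ β ∈ B', (X - C β) - C (r ^ B'.card)) (by
    rw [degree_sub_eq_left_of_degree_lt, hdeg]
    · exact_mod_cast hcard.ne'
    · rw [hdeg]
      exact degree_C_le.trans_lt (by exact_mod_cast hcard))
  have hprod : ∏ β ∈ B', (t - β) = r ^ B'.card := by
    simpa [IsRoot, eval_prod, sub_eq_zero] using ht
  have hsum : (B'.val.map fun β => w (t - β)).sum = (B'.val.map fun _ => w r).sum := by
    have h1 := congrArg w hprod
    rw [Finset.prod, addValuation_multiset_prod, Multiset.map_map, w.map_pow] at h1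
    rw [Multiset.map_const', Multiset.sum_replicate]
    exact h1
  have hr' : w r ≠ ⊤ := w.ne_top_iff.2 hr
  have hconst : ∀ c : WithTop Λ, c ≠ ⊤ → (B'.val.map fun _ => c).sum ≠ ⊤ := fun c hc => by
    obtain ⟨b, rfl⟩ := WithTop.ne_top_iff_exists.1 hc
    rw [Multiset.map_const', Multiset.sum_replicate, ← WithTop.coe_nsmul]
    exact WithTop.coe_ne_top
  have hαB : α ∈ B'.val := Finset.mem_insert_self _ _
  have htα : w r ≤ w (t - α) := by
    by_contra! hlt
    have e : ∀ β ∈ B'.val, w (t - β) = w (t - α) := fun β hβ => by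
      rw [← sub_add_sub_cancel t α β]
      exact w.map_add_eq_of_lt_left (hlt.trans_le (hclose β hβ))
    have h1 := sum_map_lt_sum_map_of_ne_top (f := fun _ => w (t - α)) (g := fun _ => w r)
      (fun _ _ => hlt.le) hαB hlt (hconst _ hlt.ne_top)
    rw [← hsum, Multiset.map_congr rfl e] at h1
    exact lt_irrefl _ h1
  have hge : ∀ β ∈ B'.val, w r ≤ w (t - β) := fun β hβ => by
    rw [← sub_add_sub_cancel t α β]
    exact w.map_le_add htα (hclose β hβ)
  have heq : ∀ β ∈ B'.val, w (t - β) = w r := fun β hβ => by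
    refine ((hge β hβ).eq_or_lt.resolve_right fun hlt => ?_).symm
    exact (sum_map_lt_sum_map_of_ne_top hge hβ hlt (hconst _ hr')).ne' hsum
  refine ⟨t, by rw [w.map_sub_swap, heq α hαB], fun β hβ => ?_⟩
  rcases le_or_gt (w r) (w (α - β)) with hle | hlt
  · rw [min_eq_left hle]
    exact heq β (Finset.mem_insert_of_mem (Finset.mem_filter.2 ⟨hβ, hle⟩))
  · rw [min_eq_right hlt.le, ← sub_add_sub_cancel t α β]
    exact w.map_add_eq_of_lt_right (by rwa [heq α hαB])

end GenericPoint

/-! ### Newton polygon and `μ`-equivalence with a power of `φ` -/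

namespace IsGeometricExtension

variable {K : Type u} [Field K] {A : Type*} [Field A] [Algebra K A] [IsAlgClosed A]
  [Algebra.IsAlgebraic K A]
variable {Λ : Type w} [AddCommGroup Λ] [LinearOrder Λ] [IsOrderedAddMonoid Λ]
variable {w : AddValuation A (WithTop Λ)} {μ : AddValuation K[X] (WithTop Λ)}
  {ν : AddValuation A[X] (WithTop Λ)} {φ : K[X]} {α : A}

/-- The roots of `a` stay outside the open ball around `α` that contains `t`, so they are as far
from `t` as from `α`. -/
theorem map_aeval_eq_of_close (h : IsGeometricExtension w μ ν)
    (hφ : IsKeyPolynomial μ φ) (hα : IsNearestRoot ν φ α)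
    {a : K[X]} (hdeg : a.degree < φ.degree) {t : A}
    (ht : ν (X - C α) < w (α - t)) : w (aeval t a) = μ a := by
  rcases eq_or_ne a 0 with rfl | ha
  · simp
  rw [← h.map_aeval_eq_of_degree_lt hφ hα hdeg, addValuation_aeval_eq_sum,
    addValuation_aeval_eq_sum]
  congr 2
  refine Multiset.map_congr rfl fun β hβ => ?_
  have h1 := h.map_sub_le_of_degree_lt hφ hα ha hdeg (mem_aroots.1 hβ).2
  rw [← sub_sub_sub_cancel_left β t α]
  exact w.map_sub_eq_of_lt_left (h1.trans_lt ht)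

theorem map_aeval_eq_map_expansionCoeff_zero (h : IsGeometricExtension w μ ν)
    (hφ : IsKeyPolynomial μ φ) (hα : IsNearestRoot ν φ α)
    (f : K[X]) :
    w (aeval α f) = μ (expansionCoeff φ f 0) := by
  rw [expansionCoeff, pow_zero, divByMonic_one,
    ← h.map_aeval_eq_of_degree_lt hφ hα (degree_modByMonic_lt f hφ.monic),
    aeval_modByMonic_eq_self_of_root hα.aeval_eq_zero]

/-- The cloud of points of the `φ`-expansion of `F` lies above the line of slope `-v_F(φ)` through
its leftmost point. -/
theorem map_aeval_le_expansionCoeff (h : IsGeometricExtension w μ ν)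
    (hφ : IsKeyPolynomial μ φ) (hα : IsNearestRoot ν φ α)
    {F : K[X]} (hFm : F.Monic) (hF : Irreducible F)
    (hFφ : aeval α F ≠ 0) (hdvd : MuDvd μ φ F) {θ : A} (hθ : aeval θ F = 0) (s : ℕ) :
    w (aeval α F) ≤ μ (expansionCoeff φ F s) + s • w (aeval θ φ) := by
  classical
  obtain ⟨θ₀, hθ₀, hlt₀⟩ := (h.muDvd_iff_exists_close hφ hα hFm.ne_zero).1 hdvd
  have hmem : ∀ γ : A, γ ∈ (F.aroots A).toFinset ↔ aeval γ F = 0 := fun γ => by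
    rw [Multiset.mem_toFinset, mem_aroots]
    exact and_iff_right hFm.ne_zero
  obtain ⟨η, hη', hmax'⟩ := (F.aroots A).toFinset.exists_max_image (fun γ => w (α - γ))
    ⟨θ₀, (hmem _).2 hθ₀⟩
  have hη := (hmem η).1 hη'
  have hmax : ∀ γ, aeval γ F = 0 → w (α - γ) ≤ w (α - η) := fun γ hγ => hmax' γ ((hmem γ).2 hγ)
  have hlt : ν (X - C α) < w (α - η) := hlt₀.trans_le (hmax θ₀ hθ₀)
  have hr : α - η ≠ 0 := by
    intro h0
    rw [sub_eq_zero.1 h0] at hFφ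
    exact hFφ hη
  obtain ⟨t, htα, ht⟩ := exists_generic_point w α hr (((φ.aroots A).toFinset) ∪
    (Finset.range (F.natDegree + 1)).biUnion fun s => ((F /ₘ φ ^ s).aroots A).toFinset)
  have ht' : ν (X - C α) < w (α - t) := htα ▸ hlt
  have hquot : ∀ s, ∀ β ∈ (F /ₘ φ ^ s).aroots A, w (t - β) = min (w (α - η)) (w (α - β)) := by
    intro s β hβ
    refine ht β (Finset.mem_union_right _ (Finset.mem_biUnion.2 ⟨s, ?_, by simpa using hβ⟩))
    rw [Finset.mem_range]
    by_contra hs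
    -- Beyond `s = deg F` the quotients vanish, so finitely many root sets suffice.
    have h0 : F /ₘ φ ^ s = 0 := by
      rw [divByMonic_eq_zero_iff (hφ.monic.pow s)]
      refine degree_lt_degree ?_
      rw [natDegree_pow]
      nlinarith [hφ.natDegree_pos]
    simp [h0] at hβ
  have htF : w (aeval t F) = w (aeval α F) := by
    rw [addValuation_aeval_eq_sum_of_monic _ _ hFm, addValuation_aeval_eq_sum_of_monic _ _ hFm]
    congr 1
    refine Multiset.map_congr rfl fun β hβ => ?_
    rw [hquot 0 β (by simpa using hβ), min_eq_right (hmax β (mem_aroots.1 hβ).2)]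
  have htφ : w (aeval t φ) = w (aeval θ φ) := by
    rw [addValuation_aeval_eq_of_conj h.map_algEquiv hF hθ hη,
      addValuation_aeval_eq_sum_of_monic _ _ hφ.monic,
      addValuation_aeval_eq_sum_of_monic _ _ hφ.monic]
    congr 1
    refine Multiset.map_congr rfl fun β hβ => ?_
    rw [ht β (Finset.mem_union_left _ (by simpa using hβ))]
    rcases eq_or_ne (w (α - η)) (w (α - β)) with heq | hne
    · rw [← heq, min_self]
      apply le_antisymm
      · rw [← sub_sub_sub_cancel_left β η α]
        exact w.map_le_sub heq.le le_rfl
      -- If `β` were closer to `η` than `α` is, moving `β` to `α` would give a conjugate of `η`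
      -- closer to `α` than `η`.
      · obtain ⟨σ, hσ⟩ := exists_algEquiv_of_irreducible hφ.irreducible_polynomial (mem_aroots.1 hβ).2
          hα.aeval_eq_zero
        have h1 := hmax (σ η) (by rw [aeval_algHom_apply, hη, map_zero])
        rwa [← hσ, ← _root_.map_sub, h.map_algEquiv, hσ, w.map_sub_swap] at h1
    · have e : η - β = (α - β) + -(α - η) := by ring
      rw [e, w.map_add_of_distinct_val (by rwa [w.map_neg, ne_comm]), w.map_neg, min_comm]
  have key := map_le_map_expansionCoeff_mul hφ.monic
    (ω := w.comap (aeval (R := K) t).toRingHom) (f := F) (fun s => ?_) s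
  · change w (aeval t F) ≤ w (aeval t (expansionCoeff φ F s * φ ^ s)) at key
    rwa [_root_.map_mul, _root_.map_pow, w.map_mul, w.map_pow, htF, htφ,
      h.map_aeval_eq_of_close hφ hα (degree_expansionCoeff_lt hφ.monic F s) ht'] at key
  · change w (aeval t (F /ₘ φ ^ s)) ≤ w (aeval t (expansionCoeff φ F s))
    rw [h.map_aeval_eq_of_close hφ hα (degree_expansionCoeff_lt hφ.monic F s) ht', expansionCoeff,
      ← h.map_aeval_eq_of_degree_lt hφ hα (degree_modByMonic_lt _ hφ.monic),
      aeval_modByMonic_eq_self_of_root hα.aeval_eq_zero, addValuation_aeval_eq_sum,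
      addValuation_aeval_eq_sum]
    gcongr 1
    refine Multiset.sum_map_le_sum_map _ _ fun β hβ => ?_
    rw [hquot s β hβ]
    exact min_le_right _ _

/-- The value of the resultant of two irreducible polynomials, computed in two ways. -/
theorem natDegree_nsmul_map_aeval_comm (hw : ∀ (σ : A ≃ₐ[K] A) (x : A), w (σ x) = w x)
    {F G : K[X]} (hFm : F.Monic) (hF : Irreducible F) (hGm : G.Monic) (hG : Irreducible G)
    {θ η : A} (hθ : aeval θ F = 0) (hη : aeval η G = 0) :
    G.natDegree • w (aeval η F) = F.natDegree • w (aeval θ G) := by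
  have key : ∀ {P Q : K[X]}, P.Monic → Q.Monic → Irreducible Q → ∀ {x : A}, aeval x Q = 0 →
      Q.natDegree • w (aeval x P) =
        ((Q.aroots A).map fun b => ((P.aroots A).map fun a => w (a - b)).sum).sum := by
    intro P Q hP hQm hQ x hx
    have e : ∀ b ∈ Q.aroots A, ((P.aroots A).map fun a => w (a - b)).sum = w (aeval x P) := by
      intro b hb
      rw [addValuation_aeval_eq_of_conj hw hQ hx (mem_aroots.1 hb).2,
        addValuation_aeval_eq_sum_of_monic _ _ hP]
      simp only [w.map_sub_swap b]
    rw [Multiset.map_congr rfl e, Multiset.map_const', Multiset.sum_replicate]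
    congr 1
    rw [aroots_def, ← (IsAlgClosed.splits (Q.map (algebraMap K A))).natDegree_eq_card_roots,
      natDegree_map]
  rw [key hFm hGm hG hη, key hGm hFm hF hθ, Multiset.sum_map_sum_map]
  simp only [w.map_sub_swap]

/-- If `φ ∣_μ F`, then the leading coefficient of the `φ`-expansion of `F` is `1`, and the leftmost
point of its Newton polygon has ordinate `(deg F / deg φ) v_F(φ)`. -/
theorem divByMonic_pow_eq_one (h : IsGeometricExtension w μ ν) (hφ : IsKeyPolynomial μ φ)
    (hα : IsNearestRoot ν φ α) {F : K[X]} (hFm : F.Monic) (hF : Irreducible F)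
    (hFα : aeval α F ≠ 0) (hdvd : MuDvd μ φ F) {θ : A} (hθ : aeval θ F = 0) {γ : Λ}
    (hγ : w (aeval θ φ) = γ) :
    φ.natDegree ∣ F.natDegree ∧ F /ₘ φ ^ (F.natDegree / φ.natDegree) = 1 ∧
      w (aeval α F) = (((F.natDegree / φ.natDegree) • γ : Λ) : WithTop Λ) := by
  set m := φ.natDegree with hm
  set l := F.natDegree / m with hl
  have hm0 : 0 < m := hφ.natDegree_pos
  have hdiv : m * l + F.natDegree % m = F.natDegree := Nat.div_add_mod _ _
  have hlm : (φ ^ l).natDegree = m * l := by rw [natDegree_pow, mul_comm]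
  set a := F /ₘ φ ^ l with ha
  have ham : a.Monic := by
    rw [Monic, ha, leadingCoeff_divByMonic_of_monic (hφ.monic.pow l), hFm.leadingCoeff]
    rw [degree_eq_natDegree hFm.ne_zero, degree_eq_natDegree (hφ.monic.pow l).ne_zero, hlm]
    exact_mod_cast Nat.mul_div_le _ _
  have hadeg : a.natDegree = F.natDegree % m := by
    rw [ha, natDegree_divByMonic _ (hφ.monic.pow l), hlm]
    omega
  have halt : a.degree < φ.degree := degree_lt_degree (by rw [hadeg]; exact Nat.mod_lt _ hm0)
  have hexp : expansionCoeff φ F l = a := by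
    rw [expansionCoeff, ← ha, modByMonic_eq_self_iff hφ.monic]
    exact halt
  have h1 := h.map_aeval_le_expansionCoeff hφ hα hFm hF hFα hdvd hθ l
  have h2 := natDegree_nsmul_map_aeval_comm h.map_algEquiv hFm hF hφ.monic hφ.irreducible_polynomial hθ
    hα.aeval_eq_zero
  have h3 := hφ.natDegree_nsmul_map_le ham
  have h4 := (h.muDvd_iff_lt hφ hα hFm hF hθ).1 hdvd
  obtain ⟨Y, hY⟩ := WithTop.ne_top_iff_exists.1 (w.ne_top_iff.2 hFα)
  obtain ⟨b, hb⟩ := WithTop.ne_top_iff_exists.1 (hφ.map_ne_top_of_ne_zero ham.ne_zero)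
  obtain ⟨c, hc⟩ := WithTop.ne_top_iff_exists.1 hφ.map_ne_top
  rw [hexp] at h1
  rw [hγ, ← hY, ← hb] at h1
  rw [hγ, ← hY] at h2
  rw [← hb, ← hc] at h3
  rw [hγ, ← hc] at h4
  norm_cast at h1 h2 h3 h4
  rw [← hm] at h2 h3
  -- With `r = deg a`, the resultant identity and the lower bound on the cloud at `l` give `r γ ≤ m
  -- μ(a) ≤ r μ(φ)`; since `μ(φ) < γ`, this forces `r = 0`.
  have hmod : a.natDegree = 0 := by
    by_contra hne
    have h5 : a.natDegree • c < a.natDegree • γ := nsmul_lt_nsmul_right hne h4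
    have h6 : m • Y ≤ m • (b + l • γ) := by gcongr
    rw [h2, ← hdiv, ← hadeg, add_smul, smul_add, smul_smul, add_comm] at h6
    exact (h5.trans_le (le_of_add_le_add_right h6)).not_ge h3
  refine ⟨Nat.dvd_of_mod_eq_zero (hadeg.symm.trans hmod), ham.natDegree_eq_zero.1 hmod, ?_⟩
  rw [← hY]
  norm_cast
  rw [← hdiv, ← hadeg, hmod, add_zero, mul_smul] at h2
  exact nsmul_right_injective hm0.ne' h2

/-- For `s < l` the line bounds `μ(a_s)` below by `(l - s) γ`, which exceeds `(l - s) μ(φ)`. -/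
theorem muEquiv_pow (h : IsGeometricExtension w μ ν) (hφ : IsKeyPolynomial μ φ)
    (hα : IsNearestRoot ν φ α) {F : K[X]} (hFm : F.Monic) (hF : Irreducible F)
    (hFα : aeval α F ≠ 0) (hdvd : MuDvd μ φ F) {θ : A} (hθ : aeval θ F = 0) {γ : Λ}
    (hγ : w (aeval θ φ) = γ) : MuEquiv μ F (φ ^ (F.natDegree / φ.natDegree)) := by
  obtain ⟨-, hone, hY⟩ := h.divByMonic_pow_eq_one hφ hα hFm hF hFα hdvd hθ hγ
  set l := F.natDegree / φ.natDegree
  have hlt := (h.muDvd_iff_lt hφ hα hFm hF hθ).1 hdvd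
  obtain ⟨c, hc⟩ := WithTop.ne_top_iff_exists.1 hφ.map_ne_top
  have e : F - φ ^ l = ∑ s ∈ Finset.range l, expansionCoeff φ F s * φ ^ s := by
    have := sum_expansionCoeff_mul_pow hφ.monic F l
    rw [hone, one_mul] at this
    exact sub_eq_of_eq_add this.symm
  refine (muEquiv_of_lt (f := φ ^ l) (g := F) ?_).symm
  rw [e, μ.map_pow, ← hc, ← WithTop.coe_nsmul]
  refine μ.map_lt_sum WithTop.coe_ne_top fun s hs => ?_
  have hsl : s < l := Finset.mem_range.1 hs
  have h1 := h.map_aeval_le_expansionCoeff hφ hα hFm hF hFα hdvd hθ s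
  rw [hγ] at h1 hlt
  rw [← hc] at hlt
  rw [hY] at h1
  rw [μ.map_mul, μ.map_pow, ← hc]
  cases hb : μ (expansionCoeff φ F s) with
  | top =>
    rw [top_add]
    exact WithTop.coe_lt_top _
  | coe b =>
    rw [hb] at h1
    norm_cast at h1 hlt ⊢
    obtain ⟨k, hk⟩ := Nat.exists_eq_add_of_lt hsl
    have h2 : (k + 1) • c < (k + 1) • γ := nsmul_lt_nsmul_right (by omega) hlt
    have e1 : ∀ x : Λ, (s + k + 1) • x = (k + 1) • x + s • x := fun x => by
      rw [← add_smul]; congr 1; omega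
    rw [hk, e1] at h1 ⊢
    have h3 := le_of_add_le_add_right h1
    gcongr
    exact h2.trans_le h3

theorem isOneSided_newtonPolygon [Module ℚ Λ] (h : IsGeometricExtension w μ ν)
    (hφ : IsKeyPolynomial μ φ)
    (hα : IsNearestRoot ν φ α) {F : K[X]} (hFm : F.Monic) (hF : Irreducible F)
    (hFα : aeval α F ≠ 0) (hdvd : MuDvd μ φ F) {θ : A} (hθ : aeval θ F = 0) {γ : Λ}
    (hγ : w (aeval θ φ) = γ) : IsOneSided (newtonPolygon μ φ F) (-γ) := by
  obtain ⟨hdeg, hone, hY⟩ := h.divByMonic_pow_eq_one hφ hα hFm hF hFα hdvd hθ hγ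
  set l := F.natDegree / φ.natDegree with hl
  have hl0 : 0 < l := Nat.div_pos (Nat.le_of_dvd hF.natDegree_pos hdeg) hφ.natDegree_pos
  refine ⟨l • γ, l, hl0, lowerBoundary_eq_segment hl0 ?_ ?_ ?_⟩
  · exact ⟨0, by simp, by rw [← hY, h.map_aeval_eq_map_expansionCoeff_zero hφ hα]⟩
  · refine ⟨l, rfl, ?_⟩
    rw [expansionCoeff, hone, (modByMonic_eq_self_iff hφ.monic).2 (by
      rw [degree_one]; exact natDegree_pos_iff_degree_pos.1 hφ.natDegree_pos), μ.map_one]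
    simp
  · rintro ⟨p, b⟩ ⟨s, hs, hb⟩
    simp only at hs hb
    subst hs
    have h1 := h.map_aeval_le_expansionCoeff hφ hα hFm hF hFα hdvd hθ s
    rw [hγ, hY, ← hb] at h1
    norm_cast at h1
    refine ⟨by positivity, ?_, by simpa [Nat.cast_smul_eq_nsmul] using h1⟩
    -- For `s > l` the coefficient is zero, of value `⊤`, and contributes no point.
    by_contra! hlt
    have hls : l < s := by simpa using hlt
    have h0 : F /ₘ φ ^ s = 0 := by
      rw [divByMonic_eq_zero_iff (hφ.monic.pow s)]
      refine degree_lt_degree ?_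
      rw [natDegree_pow, ← Nat.div_mul_cancel hdeg]
      exact Nat.mul_lt_mul_of_pos_right hls hφ.natDegree_pos
    rw [expansionCoeff, h0, zero_modByMonic, μ.map_zero] at hb
    exact WithTop.coe_ne_top hb

end IsGeometricExtension

end ValTree

end

theorem mainTheorem9 {K : Type*} [Field K]
    {Λ : Type*} [AddCommGroup Λ] [LinearOrder Λ] [IsOrderedAddMonoid Λ] [Module ℚ Λ]
    (v : AddValuation K (WithTop Λ)) (hv : ValTree.IsHenselian v)
    (vbar : AddValuation (AlgebraicClosure K) (WithTop Λ))
    (hvbar : ∀ a : K, vbar (algebraMap K (AlgebraicClosure K) a) = v a)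
    (F : Polynomial K) (hFmonic : F.Monic) (hFirr : Irreducible F)
    (θ : AlgebraicClosure K) (hθ : Polynomial.aeval θ F = 0)
    (μ : AddValuation (Polynomial K) (WithTop Λ)) (hμ : ValTree.IsNode v μ)
    (φ : Polynomial K) (hφ : ValTree.IsKeyPolynomial μ φ) :
    (ValTree.MuDvd μ φ F ↔ μ φ < ValTree.evalValuation vbar θ φ) ∧
    (ValTree.MuDvd μ φ F →
      (F = φ ∨ ∃ γ : Λ, (γ : WithTop Λ) = ValTree.evalValuation vbar θ φ ∧
        ValTree.IsOneSided (ValTree.newtonPolygon μ φ F) (-γ)) ∧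
      (φ.natDegree ∣ F.natDegree ∧
        ValTree.MuEquiv μ F (φ ^ (F.natDegree / φ.natDegree)))) := by
  obtain ⟨ν, hνC, hνmap⟩ := hv.exists_extension_polynomial hvbar hμ
    fun _ hf => hφ.eq_zero_of_map_eq_top hf
  have h : ValTree.IsGeometricExtension vbar μ ν := ⟨hνC, hνmap, hv.map_algEquiv hvbar⟩
  obtain ⟨α, hα⟩ := hφ.exists_isNearestRoot ν
  have heval : ValTree.evalValuation vbar θ φ = vbar (Polynomial.aeval θ φ) := rfl
  rw [heval]
  refine ⟨h.muDvd_iff_lt hφ hα hFmonic hFirr hθ, fun hdvd => ?_⟩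
  have heq : ∀ β : AlgebraicClosure K, Polynomial.aeval β F = 0 → Polynomial.aeval β φ = 0 →
      F = φ := fun β h1 h2 =>
    (minpoly.eq_of_irreducible_of_monic hFirr h1 hFmonic).trans
      (minpoly.eq_of_irreducible_of_monic hφ.irreducible_polynomial h2 hφ.monic).symm
  -- For `F = φ` the values `w(F(α))` and `v_F(φ)` are infinite. Otherwise `F` and `φ` share no root
  -- and both values are finite.
  rcases eq_or_ne F φ with rfl | hne
  · refine ⟨Or.inl rfl, dvd_rfl, ?_⟩
    rw [Nat.div_self hφ.natDegree_pos, pow_one]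
    rfl
  · have hFα : Polynomial.aeval α F ≠ 0 := fun h0 => hne (heq α h0 hα.aeval_eq_zero)
    obtain ⟨γ, hγ⟩ := WithTop.ne_top_iff_exists.1
      (vbar.ne_top_iff.2 fun h0 => hne (heq θ hθ h0))
    exact ⟨Or.inr ⟨γ, hγ, h.isOneSided_newtonPolygon hφ hα hFmonic hFirr hFα hdvd hθ hγ.symm⟩,
      (h.divByMonic_pow_eq_one hφ hα hFmonic hFirr hFα hdvd hθ hγ.symm).1,
      h.muEquiv_pow hφ hα hFmonic hFirr hFα hdvd hθ hγ.symm⟩
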